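/- Let $B_3=\langle \sigma_1,\sigma_2 \mid \sigma_1\sigma_2\sigma_1=\sigma_2\sigma_1\sigma_2\rangle$, let $T$ and $U$ be the classes in $\mathrm{PSL}(2,\mathbb{Z})=\mathrm{SL}(2,\mathbb{Z})/\{\pm1\}$ of $\begin{pmatrix}1&1\\0&1\end{pmatrix}$ and $\begin{pmatrix}1&0\\1&1\end{pmatrix}$, and let $\pi\colon B_3\to\mathrm{PSL}(2,\mathbb{Z})$ be the quotient map with $\pi(\sigma_1)=T$, $\pi(\sigma_2)=U^{-1}$. For $N\ge 1$ let $\Gamma(N)\subseteq\mathrm{PSL}(2,\mathbb{Z})$ be the subgroup of classes of matrices congruent to $\pm 1$ modulo $N$. A finite-index subgroup $G$ of $\mathrm{PSL}(2,\mathbb{Z})$ is a congruence subgroup if $\Gamma(N)\subseteq G$ for some $N>1$, and its level is then the least $N\ge1$ with $\Gamma(N)\subseteq G$. For a complex square matrix $A$ with eigenvalues $\lambda_1,\dots,\lambda_d$, the projective order $\mathrm{po}(A)\in\{2,3,\dots\}\cup\{\infty\}$ is the least integer $t>1$ with $\lambda_1^t=\dots=\lambda_d^t$ ($\infty$ if there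 is none). A scaling of a representation $\rho\colon G\to\mathrm{GL}(d,\mathbb{C})$ is a representation of the form $g\mapsto\chi(g)\rho(g)$ with $\chi\colon G\to\mathbb{C}^*$ a character, and $\rho$ is essentially finite if some scaling of it has finite image. (a) Let $d=2$ or $3$ and let $\rho\colon B_3\to\mathrm{GL}(d,\mathbb{C})$ be irreducible and essentially finite with $2\le\mathrm{po}(\rho(\sigma_1))\le5$. Then there is a scaling $\tilde\rho$ of $\rho$ that factors through $\pi$ such that $\pi(\ker\tilde\rho)$ is a congruence subgroup whose level equals the order $N$ of $\tilde\rho(\sigma_1)$. (b) Let $\rho\colon\mathrm{PSL}(2,\mathbb{Z})\to\mathrm{GL}(2,\mathbb{C})$ be irreducible with finite image. Then $\ker\rho$ is a congruence subgroup whose level equals the order of $\rho(T)$. (c) Let $\rho\colon\mathrm{PSL}(2,\mathbb{Z})\to\mathrm{GL}(3,\mathbb{C})$ be irreducible with finite image and $2\le\mathrm{po}(\rho(T))\le5$. Then $\ker\rho$ is a congruence subgroup whose level equals the order of $\rho(T)$. -/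

import Mathlib

open scoped MatrixGroups

/-! ### The braid group on three strands and the modular group -/

/-- The defining relation `σ₁ σ₂ σ₁ = σ₂ σ₁ σ₂` of the braid group on three strands, as a relator
in the free group on two generators (`0` stands for `σ₁` and `1` for `σ₂`). -/
def braidRels : Set (FreeGroup (Fin 2)) :=
  {FreeGroup.of 0 * FreeGroup.of 1 * FreeGroup.of 0 *
    (FreeGroup.of 1 * FreeGroup.of 0 * FreeGroup.of 1)⁻¹}

/-- The braid group `B₃` on three strands, in its Artin presentation. -/
abbrev BraidGroup3 : Type := PresentedGroup braidRels

/-- The braid generator `σ₁`. -/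
def braidσ₁ : BraidGroup3 := PresentedGroup.of 0

/-- The braid generator `σ₂`. -/
def braidσ₂ : BraidGroup3 := PresentedGroup.of 1

/-- The matrix `[[1, 0], [1, 1]]` in `SL(2, ℤ)`. -/
def matU : SL(2, ℤ) := ⟨!![1, 0; 1, 1], by simp [Matrix.det_fin_two_of]⟩

/-- The class of `[[1, 1], [0, 1]]` in `PSL(2, ℤ)`. -/
def modT : PSL(2, ℤ) := QuotientGroup.mk ModularGroup.T

/-- The class of `[[1, 0], [1, 1]]` in `PSL(2, ℤ)`. -/
def modU : PSL(2, ℤ) := QuotientGroup.mk matU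

theorem braid_relation_modular :
    ModularGroup.T * matU⁻¹ * ModularGroup.T = matU⁻¹ * ModularGroup.T * matU⁻¹ := by
  decide

theorem braidRels_modular (r : FreeGroup (Fin 2)) (hr : r ∈ braidRels) :
    FreeGroup.lift ![modT, modU⁻¹] r = 1 := by
  rw [braidRels, Set.mem_singleton_iff] at hr
  subst hr
  have h := congrArg (QuotientGroup.mk' (Subgroup.center SL(2, ℤ))) braid_relation_modular
  simp only [map_mul, map_inv] at h
  simp only [map_mul, map_inv, FreeGroup.lift_apply_of, Matrix.cons_val_zero, Matrix.cons_val_one]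
  rw [mul_inv_eq_one]
  exact h

/-- The quotient map `π : B₃ → PSL(2, ℤ)`, with `π(σ₁) = T` and `π(σ₂) = U⁻¹`. -/
def braidProj : BraidGroup3 →* PSL(2, ℤ) := PresentedGroup.toGroup braidRels_modular

/-! ### Congruence subgroups of `PSL(2, ℤ)` and their level -/

/-- The principal congruence subgroup `Γ(N)` of `PSL(2, ℤ) = SL(2, ℤ) / {± 1}`: the image of the
group of matrices that are congruent to the identity modulo `N`. By
`mem_principalPSL_iff` it consists of the classes of the matrices congruent to `1` or `-1`
modulo `N`, that is, it is the kernel of reduction modulo `N` from `SL(2, ℤ) / {± 1}` to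
`SL(2, ℤ/N) / {± 1}`. -/
def principalPSL (N : ℕ) : Subgroup PSL(2, ℤ) :=
  (CongruenceSubgroup.Gamma N).map (QuotientGroup.mk' (Subgroup.center SL(2, ℤ)))

theorem mem_center_SL2Z_iff (A : SL(2, ℤ)) :
    A ∈ Subgroup.center SL(2, ℤ) ↔ A = 1 ∨ A = -1 := by
  rw [Matrix.SpecialLinearGroup.mem_center_iff]
  constructor
  · rintro ⟨r, hr, hA⟩
    rw [Fintype.card_fin, sq_eq_one_iff] at hr
    rcases hr with rfl | rfl
    · left; ext i j; rw [← hA]; simp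
    · right; ext i j; rw [← hA]; simp
  · rintro (rfl | rfl)
    · exact ⟨1, by simp, by simp⟩
    · exact ⟨-1, by simp, by simp⟩

theorem mem_principalPSL_iff (N : ℕ) (A : SL(2, ℤ)) :
    (QuotientGroup.mk A : PSL(2, ℤ)) ∈ principalPSL N ↔
      Matrix.SpecialLinearGroup.map (Int.castRingHom (ZMod N)) A = 1 ∨
      Matrix.SpecialLinearGroup.map (Int.castRingHom (ZMod N)) A = -1 := by
  have hneg : ∀ B : SL(2, ℤ), Matrix.SpecialLinearGroup.map (Int.castRingHom (ZMod N)) (-B) =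
      -Matrix.SpecialLinearGroup.map (Int.castRingHom (ZMod N)) B := by
    intro B; ext i j; simp
  constructor
  · rintro ⟨B, hB, hBA⟩
    have hB1 : Matrix.SpecialLinearGroup.map (Int.castRingHom (ZMod N)) B = 1 := hB
    have h : B⁻¹ * A ∈ Subgroup.center SL(2, ℤ) := QuotientGroup.eq.mp hBA
    rcases (mem_center_SL2Z_iff _).mp h with h | h
    · left
      rw [inv_mul_eq_one.mp h] at hB1
      exact hB1
    · right
      have hA : A = -B := by rw [inv_mul_eq_iff_eq_mul.mp h]; simp
      rw [hA, hneg, hB1]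
  · rintro (h | h)
    · exact ⟨A, h, rfl⟩
    · refine ⟨-A, ?_, ?_⟩
      · change Matrix.SpecialLinearGroup.map (Int.castRingHom (ZMod N)) (-A) = 1
        rw [hneg, h, neg_neg]
      · refine QuotientGroup.eq.mpr ((mem_center_SL2Z_iff _).mpr (Or.inr ?_))
        rw [inv_mul_eq_iff_eq_mul]; simp

/-- A congruence subgroup of `PSL(2, ℤ)`: a subgroup of finite index that contains some principal
congruence subgroup `Γ(N)` with `N > 1`. -/
def IsCongruencePSL (G : Subgroup PSL(2, ℤ)) : Prop :=
  G.FiniteIndex ∧ ∃ N : ℕ, 1 < N ∧ principalPSL N ≤ G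

/-- The level of a congruence subgroup of `PSL(2, ℤ)`: the least `N ≥ 1` with `Γ(N) ⊆ G`. -/
noncomputable def levelPSL (G : Subgroup PSL(2, ℤ)) : ℕ :=
  sInf {N : ℕ | 1 ≤ N ∧ principalPSL N ≤ G}

/-! ### Matrix representations -/

/-- The projective order of a complex square matrix: the least integer `t > 1` for which all
eigenvalues have the same `t`-th power, and `⊤` (infinity) if there is none. -/
noncomputable def projOrder {d : ℕ} (A : Matrix (Fin d) (Fin d) ℂ) : ℕ∞ :=
  sInf {s : ℕ∞ | ∃ t : ℕ, s = t ∧ 1 < t ∧ ∀ a b : ℂ,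
    Module.End.HasEigenvalue (Matrix.toLin' A) a →
    Module.End.HasEigenvalue (Matrix.toLin' A) b → a ^ t = b ^ t}

/-- The linear representation on `ℂ^d` given by a homomorphism to `GL(d, ℂ)`. -/
noncomputable def matRep {G : Type*} [Group G] {d : ℕ} (ρ : G →* GL (Fin d) ℂ) :
    Representation ℂ G (Fin d → ℂ) where
  toFun g := Matrix.toLin' (ρ g : Matrix (Fin d) (Fin d) ℂ)
  map_one' := by simp [Module.End.one_eq_id]
  map_mul' g h := by simp [Matrix.toLin'_mul, Module.End.mul_eq_comp]

/-- `ρ` is irreducible: `ℂ^d` is nonzero and has no invariant subspaces but `0` and `ℂ^d`. -/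
def IsIrreducibleRep {G : Type*} [Group G] {d : ℕ} (ρ : G →* GL (Fin d) ℂ) : Prop :=
  (matRep ρ).IsIrreducible

/-- `ρ` has finite image. -/
def HasFiniteImage {G : Type*} [Group G] {d : ℕ} (ρ : G →* GL (Fin d) ℂ) : Prop :=
  (Set.range ρ).Finite

/-- `ρ'` is a scaling of `ρ`: it is the twist of `ρ` by a character `χ : G → ℂˣ`. (A character of
the braid group is determined by its common value `θ` on the braid generators.) -/
def IsScaling {G : Type*} [Group G] {d : ℕ} (ρ' ρ : G →* GL (Fin d) ℂ) : Prop :=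
  ∃ χ : G →* ℂˣ, ∀ g : G,
    (ρ' g : Matrix (Fin d) (Fin d) ℂ) = (χ g : ℂ) • (ρ g : Matrix (Fin d) (Fin d) ℂ)

/-- `ρ` is essentially finite: some scaling of `ρ` has finite image. -/
def IsEssentiallyFinite {G : Type*} [Group G] {d : ℕ} (ρ : G →* GL (Fin d) ℂ) : Prop :=
  ∃ ρ' : G →* GL (Fin d) ℂ, IsScaling ρ' ρ ∧ HasFiniteImage ρ'

/-! Let `ρ` be a representation of PSL(2, ℤ) with `ρ(T)` of finite order `N`, not scalar, of
projective order `n ≤ 5`. Finite order makes `ρ(T)` diagonalizable, so `z = ρ(T)ⁿ` is scalar, hence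
central, and `n ∣ N`. For `2 ≤ n ≤ 5` the triangle group PSL(2, ℤ)/⟨⟨Tⁿ⟩⟩ is finite and equals SL(2,
ℤ/n)/{±1}, so Γ(n) is, up to sign, the normal closure of `Tⁿ`
(`exists_mem_normalClosure_of_mem_Gamma`). As `z` is central, an element of this closure that is a
product of conjugates of `T^{±n}` with exponent sum `k` is sent to `z^k`. It remains to see that `m
= N/n`, the order of `z`, divides `k` for elements of Γ(N) (`map_eq_one_of_mem_Gamma`). Explicit
relations show that `m` divides 3, 4, 6, 12 for `n` = 2, 3, 4, 5 (`map_T_pow_pow_length_eq_one`).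
Modulo such `m` the exponent can be read off from matrix entries, by the characters of SL(2, ℤ) of
order 3 and 4 and, for `n = 4`, by a parity on Γ(4)/Γ(8). The level is exactly `N` because `T^M ∈
Γ(M)`.

In dimension two the bound `n ≤ 5` is automatic. If `r` is the ratio of the eigenvalues of `ρ(T)`,
then `r + r⁻¹ + 1` is the trace of an element of determinant 1 and finite order, so every Galois
conjugate of it is at most 2. This forces the order of `r` to be at most 6 (`orderOf_le_six`), and
order 6 would give a nontrivial unipotent of finite order (`projOrder_le_five_of_braid`).

For the braid group, Schur's lemma makes the full twist `(σ₁σ₂)³` scalar, and a scaling turns this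
scalar into 1. The kernel of `π` is generated by the full twist (`braidProj_ker_le_ker`), so the
scaled representation factors through PSL(2, ℤ), while projective orders do not grow under scaling.
-/

/-! ### Coset enumeration in quotients of the modular group -/

section CosetEnumeration

variable {Q : Type*} [Group Q] {s t : Q}

theorem exists_natPow_eq_zpow {n : ℕ} (hn : 0 < n) (ht : t ^ n = 1) (j : ℤ) :
    ∃ r < n, t ^ j = t ^ r := by
  refine ⟨(j % n).toNat, ?_, ?_⟩
  · have := Int.emod_lt_of_pos j (Int.natCast_pos.mpr hn)
    have := Int.emod_nonneg j (Int.natCast_ne_zero.mpr hn.ne')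
    omega
  · rw [← zpow_natCast, Int.toNat_of_nonneg (Int.emod_nonneg j (Int.natCast_ne_zero.mpr hn.ne')),
      Int.emod_def, zpow_sub, zpow_mul, zpow_natCast, ht]
    simp

theorem closure_pair_induction (hs : s * s = 1) {P : Q → Prop} (one : P 1)
    (mul_s : ∀ x, P x → P (x * s)) (mul_t : ∀ x, ∀ k : ℤ, P x → P (x * t ^ k)) {x : Q}
    (hx : x ∈ Subgroup.closure {s, t}) : P x := by
  induction hx using Subgroup.closure_induction_right with
  | one => exact one
  | mul_right x hx y hy ih =>
    rcases hy with rfl | rfl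
    · exact mul_s _ ih
    · simpa using mul_t _ 1 ih
  | mul_inv_cancel x hx y hy ih =>
    rcases hy with rfl | rfl
    · rw [inv_eq_of_mul_eq_one_left hs]; exact mul_s _ ih
    · simpa using mul_t _ (-1) ih

/-- The hypothesis `h` is the relation `(ts)³ = 1` in the form of a rewriting rule: with `s² = 1` it
removes one `s` from any word containing `s t^{±1} s`. The normal forms below are obtained by
rewriting with it. -/
theorem conj_inv_of_conj (hs : s * s = 1) (h : s * t * s = t⁻¹ * s * t⁻¹) :
    s * t⁻¹ * s = t * s * t := by
  calc s * t⁻¹ * s = t * (t⁻¹ * s * t⁻¹) * s := by group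
    _ = t * s * t * (s * s) := by rw [← h]; group
    _ = t * s * t := by rw [hs, mul_one]

theorem conj_sq_of_conj (hs : s * s = 1) (h : s * t * s = t⁻¹ * s * t⁻¹) :
    s * t ^ 2 * s = t⁻¹ * (s * t ^ (-2 : ℤ) * s) * t⁻¹ := by
  calc s * t ^ 2 * s = s * t * 1 * t * s := by simp only [mul_one, pow_two, mul_assoc]
    _ = (s * t * s) * (s * t * s) := by rw [← hs]; group
    _ = _ := by rw [h]; group

/-- The elements `tⁱ` and `tⁱ s tʲ` exhaust the group if `t³ = 1`. -/
theorem forms_of_order_three (hs : s * s = 1) (h : s * t * s = t⁻¹ * s * t⁻¹)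
    (ht : t ^ 3 = 1) {x : Q} (hx : x ∈ Subgroup.closure {s, t}) :
    (∃ i : ℤ, x = t ^ i) ∨ ∃ i j : ℤ, x = t ^ i * s * t ^ j := by
  refine closure_pair_induction hs (P := fun x ↦ (∃ i : ℤ, x = t ^ i) ∨
    ∃ i j : ℤ, x = t ^ i * s * t ^ j) (.inl ⟨0, by simp⟩) ?_ ?_ hx
  · rintro x (⟨i, rfl⟩ | ⟨i, j, rfl⟩)
    · exact .inr ⟨i, 0, by simp⟩
    · obtain ⟨r, hr, hj⟩ := exists_natPow_eq_zpow (by norm_num) ht j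
      rw [hj]
      interval_cases r
      · exact .inl ⟨i, by simp [mul_assoc, hs]⟩
      · refine .inr ⟨i - 1, -1, ?_⟩
        rw [pow_one, mul_assoc, mul_assoc, ← mul_assoc s, h]; group
      · refine .inr ⟨i + 1, 1, ?_⟩
        rw [show t ^ 2 = t⁻¹ from eq_inv_of_mul_eq_one_left (by rw [← pow_succ, ht]), mul_assoc,
          mul_assoc, ← mul_assoc s, conj_inv_of_conj hs h]; group
  · rintro x k (⟨i, rfl⟩ | ⟨i, j, rfl⟩)
    · exact .inl ⟨i + k, by rw [zpow_add]⟩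
    · exact .inr ⟨i, j + k, by rw [zpow_add]; group⟩

/-- The elements `tⁱ` and `tⁱ s tʲ` exhaust the group if `t² = 1`. -/
theorem forms_of_order_two (hs : s * s = 1) (h : s * t * s = t⁻¹ * s * t⁻¹)
    (ht : t ^ 2 = 1) {x : Q} (hx : x ∈ Subgroup.closure {s, t}) :
    (∃ i : ℤ, x = t ^ i) ∨ ∃ i j : ℤ, x = t ^ i * s * t ^ j := by
  refine closure_pair_induction hs (P := fun x ↦ (∃ i : ℤ, x = t ^ i) ∨
    ∃ i j : ℤ, x = t ^ i * s * t ^ j) (.inl ⟨0, by simp⟩) ?_ ?_ hx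
  · rintro x (⟨i, rfl⟩ | ⟨i, j, rfl⟩)
    · exact .inr ⟨i, 0, by simp⟩
    · obtain ⟨r, hr, hj⟩ := exists_natPow_eq_zpow (by norm_num) ht j
      rw [hj]
      interval_cases r
      · exact .inl ⟨i, by simp [mul_assoc, hs]⟩
      · refine .inr ⟨i - 1, -1, ?_⟩
        rw [pow_one, mul_assoc, mul_assoc, ← mul_assoc s, h]; group
  · rintro x k (⟨i, rfl⟩ | ⟨i, j, rfl⟩)
    · exact .inl ⟨i + k, by rw [zpow_add]⟩
    · exact .inr ⟨i, j + k, by rw [zpow_add]; group⟩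

theorem mul_zpow_of_mul_eq_inv_mul {w : Q} (h : w * t = t⁻¹ * w) (k : ℤ) :
    w * t ^ k = t ^ (-k) * w := by
  have : SemiconjBy w t t⁻¹ := h
  have := this.zpow_right k
  rw [inv_zpow'] at this
  exact this

/-- The elements `tⁱ`, `tⁱ s tʲ` and `tⁱ s t² s` exhaust the group if `t⁴ = 1`. -/
theorem forms_of_order_four (hs : s * s = 1) (h : s * t * s = t⁻¹ * s * t⁻¹)
    (ht : t ^ 4 = 1) {x : Q} (hx : x ∈ Subgroup.closure {s, t}) :
    (∃ i : ℤ, x = t ^ i) ∨ (∃ i j : ℤ, x = t ^ i * s * t ^ j) ∨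
      ∃ i : ℤ, x = t ^ i * (s * t ^ 2 * s) := by
  have hinv : t ^ 3 = t⁻¹ := eq_inv_of_mul_eq_one_left (by rw [← pow_succ, ht])
  have hm2 : t ^ (-2 : ℤ) = t ^ 2 := by
    rw [zpow_neg, inv_eq_iff_mul_eq_one, ← ht]; group
  -- Moving `t` across `s t² s` inverts it, so this double coset of ⟨t⟩ needs no power of `t` on the
  -- right. The forms number at most 4 + 16 + 4 = 24, the order of S₄.
  have hw : s * t ^ 2 * s * t = t⁻¹ * (s * t ^ 2 * s) := by
    nth_rewrite 1 [conj_sq_of_conj hs h]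
    rw [hm2]; group
  refine closure_pair_induction hs (P := fun x ↦ (∃ i : ℤ, x = t ^ i) ∨
    (∃ i j : ℤ, x = t ^ i * s * t ^ j) ∨ ∃ i : ℤ, x = t ^ i * (s * t ^ 2 * s))
    (.inl ⟨0, by simp⟩) ?_ ?_ hx
  · rintro x (⟨i, rfl⟩ | ⟨i, j, rfl⟩ | ⟨i, rfl⟩)
    · exact .inr (.inl ⟨i, 0, by simp⟩)
    · obtain ⟨r, hr, hj⟩ := exists_natPow_eq_zpow (by norm_num) ht j
      rw [hj]
      interval_cases r
      · exact .inl ⟨i, by simp [mul_assoc, hs]⟩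
      · refine .inr (.inl ⟨i - 1, -1, ?_⟩)
        rw [pow_one, mul_assoc, mul_assoc, ← mul_assoc s, h]; group
      · exact .inr (.inr ⟨i, by simp [mul_assoc]⟩)
      · refine .inr (.inl ⟨i + 1, 1, ?_⟩)
        rw [hinv, mul_assoc, mul_assoc, ← mul_assoc s, conj_inv_of_conj hs h]; group
    · exact .inr (.inl ⟨i, 2, by
        rw [show t ^ i * (s * t ^ 2 * s) * s = t ^ i * s * t ^ 2 * (s * s) by group, hs]; group⟩)
  · rintro x k (⟨i, rfl⟩ | ⟨i, j, rfl⟩ | ⟨i, rfl⟩)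
    · exact .inl ⟨i + k, by rw [zpow_add]⟩
    · exact .inr (.inl ⟨i, j + k, by rw [zpow_add]; group⟩)
    · exact .inr (.inr ⟨i - k, by
        rw [mul_assoc, mul_zpow_of_mul_eq_inv_mul hw, sub_eq_add_neg, zpow_add, ← mul_assoc]⟩)

/-- The elements `tⁱ`, `tⁱ s tʲ`, `tⁱ s t² s tʲ` and `tⁱ s t² s t³ s` exhaust the group if
`t⁵ = 1`. -/
theorem forms_of_order_five (hs : s * s = 1) (h : s * t * s = t⁻¹ * s * t⁻¹)
    (ht : t ^ 5 = 1) {x : Q} (hx : x ∈ Subgroup.closure {s, t}) :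
    (∃ i : ℤ, x = t ^ i) ∨ (∃ i j : ℤ, x = t ^ i * s * t ^ j) ∨
      (∃ i j : ℤ, x = t ^ i * (s * t ^ 2 * s) * t ^ j) ∨
      ∃ i : ℤ, x = t ^ i * (s * t ^ 2 * s * t ^ 3 * s) := by
  have hinv : t ^ 4 = t⁻¹ := eq_inv_of_mul_eq_one_left (by rw [← pow_succ, ht])
  have hm2 : t ^ (-2 : ℤ) = t ^ 3 := by
    rw [zpow_neg, inv_eq_iff_mul_eq_one, ← ht]; group
  have h1 := conj_inv_of_conj hs h
  have h2 : s * t ^ 2 * s = t⁻¹ * (s * t ^ 3 * s) * t⁻¹ := by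
    rw [conj_sq_of_conj hs h, hm2]
  have h3 : s * t ^ 3 * s = t * (s * t ^ 2 * s) * t := by rw [h2]; group
  have h4 : s * t ^ 2 * s * t ^ 2 * s = t⁻¹ * (s * t ^ 2 * s) * t⁻¹ := by
    rw [conj_sq_of_conj hs h]
    calc t⁻¹ * (s * t ^ (-2 : ℤ) * s) * t⁻¹ * t ^ 2 * s
        = t⁻¹ * s * t ^ (-2 : ℤ) * (s * t * s) := by group
      _ = t⁻¹ * (s * (t ^ (-2 : ℤ) * t⁻¹) * s) * t⁻¹ := by rw [h]; group
      _ = _ := by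
        rw [show t ^ (-2 : ℤ) * t⁻¹ = t ^ 2 by
          rw [hm2, ← hinv, ← pow_add, show 3 + 4 = 5 + 2 by norm_num, pow_add, ht, one_mul],
          conj_sq_of_conj hs h]
  have h5 : s * t ^ 2 * s * t⁻¹ * s = t * (s * t ^ 2 * s) * t ^ 2 := by
    calc s * t ^ 2 * s * t⁻¹ * s = s * t ^ 2 * (s * t⁻¹ * s) := by group
      _ = s * t ^ 3 * s * t := by rw [h1]; group
      _ = _ := by rw [h3]; simp only [pow_two, mul_assoc]
  -- As for order four, the last double coset of ⟨t⟩ is a single coset. The forms number at most 5 +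
  -- 25 + 25 + 5 = 60, the order of A₅.
  have hw : s * t ^ 2 * s * t ^ 3 * s * t = t⁻¹ * (s * t ^ 2 * s * t ^ 3 * s) := by
    have : s * t ^ 2 * s * t ^ 3 * s = t * (s * t ^ 2 * s * t ^ 3 * s) * t := by
      calc s * t ^ 2 * s * t ^ 3 * s = s * t ^ 2 * (s * t ^ 3 * s) := by group
        _ = (s * t ^ 3 * s) * t ^ 2 * s * t := by nth_rewrite 1 [h3]; group
        _ = _ := by rw [h3]; group
    nth_rewrite 2 [this]
    group
  refine closure_pair_induction hs (P := fun x ↦ (∃ i : ℤ, x = t ^ i) ∨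
    (∃ i j : ℤ, x = t ^ i * s * t ^ j) ∨ (∃ i j : ℤ, x = t ^ i * (s * t ^ 2 * s) * t ^ j) ∨
      ∃ i : ℤ, x = t ^ i * (s * t ^ 2 * s * t ^ 3 * s)) (.inl ⟨0, by simp⟩) ?_ ?_ hx
  · rintro x (⟨i, rfl⟩ | ⟨i, j, rfl⟩ | ⟨i, j, rfl⟩ | ⟨i, rfl⟩)
    · exact .inr (.inl ⟨i, 0, by simp⟩)
    · obtain ⟨r, hr, hj⟩ := exists_natPow_eq_zpow (by norm_num) ht j
      rw [hj]
      interval_cases r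
      · exact .inl ⟨i, by simp [mul_assoc, hs]⟩
      · refine .inr (.inl ⟨i - 1, -1, ?_⟩)
        rw [pow_one, mul_assoc, mul_assoc, ← mul_assoc s, h]; group
      · exact .inr (.inr (.inl ⟨i, 0, by simp [mul_assoc]⟩))
      · refine .inr (.inr (.inl ⟨i + 1, 1, ?_⟩))
        rw [mul_assoc, mul_assoc, ← mul_assoc s, h3]; group
      · refine .inr (.inl ⟨i + 1, 1, ?_⟩)
        rw [hinv, mul_assoc, mul_assoc, ← mul_assoc s, h1]; group
    · obtain ⟨r, hr, hj⟩ := exists_natPow_eq_zpow (by norm_num) ht j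
      rw [hj]
      interval_cases r
      · exact .inr (.inl ⟨i, 2, by
          rw [show t ^ i * (s * t ^ 2 * s) * t ^ 0 * s = t ^ i * s * t ^ 2 * (s * s) by group, hs]
          group⟩)
      · refine .inr (.inl ⟨i - 1, -2, ?_⟩)
        calc t ^ i * (s * t ^ 2 * s) * t ^ 1 * s = t ^ i * s * t ^ 2 * (s * t * s) := by group
          _ = t ^ i * (s * t * s) * t⁻¹ := by nth_rewrite 1 [h]; group
          _ = _ := by rw [h]; group
      · refine .inr (.inr (.inl ⟨i - 1, -1, ?_⟩))
        rw [show t ^ i * (s * t ^ 2 * s) * t ^ 2 * s = t ^ i * (s * t ^ 2 * s * t ^ 2 * s) by group,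
          h4]; group
      · exact .inr (.inr (.inr ⟨i, by group⟩))
      · refine .inr (.inr (.inl ⟨i + 1, 2, ?_⟩))
        rw [hinv, show t ^ i * (s * t ^ 2 * s) * t⁻¹ * s = t ^ i * (s * t ^ 2 * s * t⁻¹ * s)
          by group, h5]; group
    · exact .inr (.inr (.inl ⟨i, 3, by
        rw [show t ^ i * (s * t ^ 2 * s * t ^ 3 * s) * s
          = t ^ i * (s * t ^ 2 * s) * t ^ 3 * (s * s) by group, hs]; group⟩))
  · rintro x k (⟨i, rfl⟩ | ⟨i, j, rfl⟩ | ⟨i, j, rfl⟩ | ⟨i, rfl⟩)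
    · exact .inl ⟨i + k, by rw [zpow_add]⟩
    · exact .inr (.inl ⟨i, j + k, by rw [zpow_add]; group⟩)
    · exact .inr (.inr (.inl ⟨i, j + k, by rw [zpow_add]; group⟩))
    · exact .inr (.inr (.inr ⟨i - k, by
        rw [mul_assoc, mul_zpow_of_mul_eq_inv_mul hw, sub_eq_add_neg, zpow_add, ← mul_assoc]⟩))

end CosetEnumeration

/-! ### Normal closures of parabolic elements -/

theorem Gamma_mono {m n : ℕ} (h : m ∣ n) :
    CongruenceSubgroup.Gamma n ≤ CongruenceSubgroup.Gamma m := by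
  intro A hA
  rw [CongruenceSubgroup.Gamma_mem] at hA ⊢
  have aux : ∀ x y : ℤ, (x : ZMod n) = y → (x : ZMod m) = y := fun x y hxy ↦ by
    simpa using congrArg (ZMod.castHom h (ZMod m)) hxy
  exact ⟨by simpa using aux _ 1 (by simpa using hA.1), by simpa using aux _ 0 (by simpa using hA.2.1),
    by simpa using aux _ 0 (by simpa using hA.2.2.1),
    by simpa using aux _ 1 (by simpa using hA.2.2.2)⟩

theorem modularT_pow_mem_Gamma (n : ℕ) : ModularGroup.T ^ n ∈ CongruenceSubgroup.Gamma n := by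
  rw [CongruenceSubgroup.Gamma_mem, ← zpow_natCast, ModularGroup.coe_T_zpow]
  simp

theorem normalClosure_le_Gamma (n : ℕ) :
    Subgroup.normalClosure {ModularGroup.T ^ n} ≤ CongruenceSubgroup.Gamma n :=
  have := CongruenceSubgroup.Gamma_normal n
  Subgroup.normalClosure_le_normal (by simpa using modularT_pow_mem_Gamma n)

theorem modularS_mul_S : ModularGroup.S * ModularGroup.S = -1 := by decide

theorem modularS_T_S :
    ModularGroup.S * ModularGroup.T * ModularGroup.S =
      ModularGroup.T⁻¹ * ModularGroup.S * ModularGroup.T⁻¹ := by decide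

theorem mem_closure_S_T_image {Q : Type*} [Group Q] (q : SL(2, ℤ) →* Q) (A : SL(2, ℤ)) :
    q A ∈ Subgroup.closure {q ModularGroup.S, q ModularGroup.T} := by
  rw [← Set.image_pair, ← MonoidHom.map_closure, SpecialLinearGroup.SL2Z_generators]
  exact ⟨A, trivial, rfl⟩

theorem coe_T_zpow_S_T_zpow (i j : ℤ) :
    ((ModularGroup.T ^ i * ModularGroup.S * ModularGroup.T ^ j : SL(2, ℤ)) :
      Matrix (Fin 2) (Fin 2) ℤ) = !![i, i * j - 1; 1, j] := by
  simp only [Matrix.SpecialLinearGroup.coe_mul, ModularGroup.coe_T_zpow, ModularGroup.coe_S]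
  ext a b; fin_cases a <;> fin_cases b <;> simp [Matrix.mul_apply, Fin.sum_univ_two, sub_eq_add_neg]

theorem coe_S_T_sq_S : ((ModularGroup.S * ModularGroup.T ^ 2 * ModularGroup.S : SL(2, ℤ)) :
      Matrix (Fin 2) (Fin 2) ℤ) = !![-1, 0; 2, -1] := by decide

theorem coe_S_T_sq_S_T_cube_S :
    ((ModularGroup.S * ModularGroup.T ^ 2 * ModularGroup.S * ModularGroup.T ^ 3 *
      ModularGroup.S : SL(2, ℤ)) : Matrix (Fin 2) (Fin 2) ℤ) = !![-3, 1; 5, -2] := by decide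

/-- For `2 ≤ n ≤ 5` the congruence subgroup `Γ(n)` is, up to sign, the normal closure of `Tⁿ`. -/
theorem exists_mem_normalClosure_of_mem_Gamma {n : ℕ} (h2 : 2 ≤ n) (h5 : n ≤ 5) {A : SL(2, ℤ)}
    (hA : A ∈ CongruenceSubgroup.Gamma n) :
    ∃ B ∈ Subgroup.normalClosure {ModularGroup.T ^ n}, A = B ∨ A = -B := by
  -- The centre is included so that `S` becomes an involution in the quotient, as the coset
  -- enumeration requires.
  set K : Subgroup SL(2, ℤ) := Subgroup.normalClosure {ModularGroup.T ^ n} ⊔ Subgroup.center _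
    with hK
  have hKmem : ∀ B, B ∈ K → ∃ C ∈ Subgroup.normalClosure {ModularGroup.T ^ n},
      B = C ∨ B = -C := by
    intro B hB
    rw [hK, Subgroup.mem_sup_of_normal_right] at hB
    obtain ⟨C, hC, D, hD, rfl⟩ := hB
    refine ⟨C, hC, ?_⟩
    rcases (mem_center_SL2Z_iff D).mp hD with rfl | rfl <;> simp
  have hneg : (-1 : SL(2, ℤ)) ∈ K :=
    Subgroup.mem_sup_right ((mem_center_SL2Z_iff _).mpr (.inr rfl))
  have hTK : ModularGroup.T ^ n ∈ K :=
    Subgroup.mem_sup_left (Subgroup.subset_normalClosure rfl)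
  have hnormal : K.Normal := Subgroup.sup_normal _ _
  apply hKmem
  set q := QuotientGroup.mk' K
  -- Since `K` consists of matrices congruent to ±1 modulo `n`, so does the coset of `A`. Any normal
  -- form representing this coset must therefore be ±1 modulo `n`, which rules out all of them
  -- except powers of `T`.
  have key : ∀ W, q A = q W → ((W 0 1 : ℤ) : ZMod n) = 0 ∧ ((W 1 0 : ℤ) : ZMod n) = 0 ∧
      (((W 1 1 : ℤ) : ZMod n) = 1 ∨ ((W 1 1 : ℤ) : ZMod n) = -1) := by
    intro W hW
    obtain ⟨C, hC, h⟩ := hKmem _ (QuotientGroup.eq.mp hW)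
    have hAC := mul_mem hA (normalClosure_le_Gamma n hC)
    rw [CongruenceSubgroup.Gamma_mem] at hAC
    obtain ⟨-, h01, h10, h11⟩ := hAC
    rcases h with h | h
    · rw [inv_mul_eq_iff_eq_mul] at h
      rw [h]
      exact ⟨h01, h10, .inl h11⟩
    · rw [inv_mul_eq_iff_eq_mul, mul_neg] at h
      rw [h]
      simp only [Matrix.SpecialLinearGroup.coe_neg, Matrix.neg_apply, Int.cast_neg, h01, h10, h11]
      simp
  have hs : q ModularGroup.S * q ModularGroup.S = 1 := by
    rw [← map_mul, modularS_mul_S]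
    exact (QuotientGroup.eq_one_iff _).mpr hneg
  have hsts : q ModularGroup.S * q ModularGroup.T * q ModularGroup.S =
      (q ModularGroup.T)⁻¹ * q ModularGroup.S * (q ModularGroup.T)⁻¹ := by
    simpa using congrArg q modularS_T_S
  have ht : q ModularGroup.T ^ n = 1 := by
    rw [← map_pow]
    exact (QuotientGroup.eq_one_iff _).mpr hTK
  have hcl := mem_closure_S_T_image q A
  have hT : (∃ i : ℤ, q A = q ModularGroup.T ^ i) → A ∈ K := by
    rintro ⟨i, hi⟩
    have h01 := (key (ModularGroup.T ^ i) (by rw [hi, map_zpow])).1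
    rw [ModularGroup.coe_T_zpow] at h01
    have h01 : ((i : ℤ) : ZMod n) = 0 := by simpa using h01
    obtain ⟨k, rfl⟩ := (ZMod.intCast_zmod_eq_zero_iff_dvd _ _).mp h01
    rw [zpow_mul, zpow_natCast, ht, one_zpow] at hi
    exact (QuotientGroup.eq_one_iff _).mp hi
  have hTST : ¬ ∃ i j : ℤ, q A = q ModularGroup.T ^ i * q ModularGroup.S * q ModularGroup.T ^ j := by
    rintro ⟨i, j, h⟩
    have h10 := (key (ModularGroup.T ^ i * ModularGroup.S * ModularGroup.T ^ j)
      (by simpa using h)).2.1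
    rw [coe_T_zpow_S_T_zpow] at h10
    have : Fact (1 < n) := ⟨by omega⟩
    simp at h10
  interval_cases n
  · rcases forms_of_order_two hs hsts ht hcl with h | h
    exacts [hT h, (hTST h).elim]
  · rcases forms_of_order_three hs hsts ht hcl with h | h
    exacts [hT h, (hTST h).elim]
  · rcases forms_of_order_four hs hsts ht hcl with h | h | ⟨i, h⟩
    · exact hT h
    · exact (hTST h).elim
    · have h10 := (key (ModularGroup.T ^ i * (ModularGroup.S * ModularGroup.T ^ 2 *
        ModularGroup.S)) (by simpa using h)).2.1
      rw [Matrix.SpecialLinearGroup.coe_mul, coe_S_T_sq_S, ModularGroup.coe_T_zpow] at h10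
      simp [Matrix.mul_apply, Fin.sum_univ_two] at h10
      exact absurd h10 (by decide)
  · rcases forms_of_order_five hs hsts ht hcl with h | h | ⟨i, j, h⟩ | ⟨i, h⟩
    · exact hT h
    · exact (hTST h).elim
    · have h10 := (key (ModularGroup.T ^ i * (ModularGroup.S * ModularGroup.T ^ 2 *
        ModularGroup.S) * ModularGroup.T ^ j) (by simpa using h)).2.1
      rw [Matrix.SpecialLinearGroup.coe_mul, Matrix.SpecialLinearGroup.coe_mul, coe_S_T_sq_S,
        ModularGroup.coe_T_zpow, ModularGroup.coe_T_zpow] at h10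
      simp [Matrix.mul_apply, Fin.sum_univ_two] at h10
      exact absurd h10 (by decide)
    -- The lower left entry is 5, which vanishes modulo 5; the lower right entry -2 is the one that
    -- differs from ±1.
    · have h11 := (key (ModularGroup.T ^ i * (ModularGroup.S * ModularGroup.T ^ 2 *
        ModularGroup.S * ModularGroup.T ^ 3 * ModularGroup.S)) (by simpa using h)).2.2
      rw [Matrix.SpecialLinearGroup.coe_mul, coe_S_T_sq_S_T_cube_S, ModularGroup.coe_T_zpow] at h11
      simp [Matrix.mul_apply, Fin.sum_univ_two] at h11
      exact absurd h11 (by decide)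

/-- For `n ≥ 3` the sign is determined, since -1 is not congruent to 1 modulo `n`. -/
theorem mem_normalClosure_of_mem_Gamma {n : ℕ} (h3 : 3 ≤ n) (h5 : n ≤ 5) {A : SL(2, ℤ)}
    (hA : A ∈ CongruenceSubgroup.Gamma n) :
    A ∈ Subgroup.normalClosure {ModularGroup.T ^ n} := by
  obtain ⟨B, hB, rfl | rfl⟩ := exists_mem_normalClosure_of_mem_Gamma (by omega) h5 hA
  · exact hB
  · have hB1 := (CongruenceSubgroup.Gamma_mem.mp (normalClosure_le_Gamma n hB)).1
    have hA1 := (CongruenceSubgroup.Gamma_mem.mp hA).1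
    simp only [Matrix.SpecialLinearGroup.coe_neg, Matrix.neg_apply, Int.cast_neg, hB1] at hA1
    interval_cases n <;> exact absurd hA1 (by decide)

/-- Elements of the normal closure of `x` carry an exponent that counts conjugates of `x`,
for every relation between elements and exponents that is compatible with the group structure. -/
theorem exists_exponent_of_mem_normalClosure {G : Type*} [Group G] {x : G} (R : G → ℤ → Prop)
    (one : R 1 0) (mul : ∀ a b k l, R a k → R b l → R (a * b) (k + l))
    (inv : ∀ a k, R a k → R a⁻¹ (-k)) (conj : ∀ g, R (g * x * g⁻¹) 1) {a : G}
    (ha : a ∈ Subgroup.normalClosure {x}) : ∃ k, R a k := by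
  induction ha using Subgroup.closure_induction with
  | mem y hy =>
    obtain ⟨z, hz, hzy⟩ := Group.mem_conjugatesOfSet_iff.mp hy
    rw [Set.mem_singleton_iff] at hz
    subst hz
    obtain ⟨g, rfl⟩ := isConj_iff.mp hzy
    exact ⟨1, conj g⟩
  | one => exact ⟨0, one⟩
  | mul a b _ _ ha hb =>
    obtain ⟨k, hk⟩ := ha
    obtain ⟨l, hl⟩ := hb
    exact ⟨k + l, mul _ _ _ _ hk hl⟩
  | inv a _ ha =>
    obtain ⟨k, hk⟩ := ha
    exact ⟨-k, inv _ _ hk⟩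

/-! ### Characters of `SL(2, ℤ)` of order three and four -/

/-- Reduces multiplicativity to right multiplication by `S` and `T`. For functions of the entries
modulo 3 or 4 this is a finite check over residues of determinant 1. -/
theorem map_mul_of_map_mul_generators {M : Type*} [AddCommGroup M] (e : SL(2, ℤ) → M) (u v : M)
    (h1 : e 1 = 0) (hS : ∀ A, e (A * ModularGroup.S) = e A + u)
    (hT : ∀ A, e (A * ModularGroup.T) = e A + v) (A B : SL(2, ℤ)) :
    e (A * B) = e A + e B := by
  have hB : B ∈ Subgroup.closure {ModularGroup.S, ModularGroup.T} := by
    rw [SpecialLinearGroup.SL2Z_generators]; trivial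
  have hSi : ∀ A, e (A * ModularGroup.S⁻¹) = e A - u := fun A ↦ by
    rw [eq_sub_iff_add_eq, ← hS, inv_mul_cancel_right]
  have hTi : ∀ A, e (A * ModularGroup.T⁻¹) = e A - v := fun A ↦ by
    rw [eq_sub_iff_add_eq, ← hT, inv_mul_cancel_right]
  induction hB using Subgroup.closure_induction_right with
  | one => simp [h1]
  | mul_right x hx y hy ih =>
    rcases hy with rfl | rfl
    · rw [← mul_assoc, hS, hS, ih, add_assoc]
    · rw [← mul_assoc, hT, hT, ih, add_assoc]
  | mul_inv_cancel x hx y hy ih =>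
    rcases hy with rfl | rfl
    · rw [← mul_assoc, hSi, hSi, ih, add_sub_assoc]
    · rw [← mul_assoc, hTi, hTi, ih, add_sub_assoc]

/-- The character of order three of `SL(2, ℤ)`, as a function of the entries modulo 3. -/
def cubicForm (a b c d : ZMod 3) : ZMod 3 := (1 - c ^ 2) * (b * d) + c * (a + d)

/-- The character of order four of `SL(2, ℤ)`, as a function of the entries modulo 4. -/
def quarticForm (a b c d : ZMod 4) : ZMod 4 :=
  (1 - c ^ 2) * (b * d + 3 * (c - 1) * d + c + 3) + c * (a + d - 3)

theorem det_cast_eq_one (A : SL(2, ℤ)) (R : Type*) [CommRing R] :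
    ((A 0 0 : ℤ) : R) * (A 1 1 : ℤ) - ((A 0 1 : ℤ) : R) * (A 1 0 : ℤ) = 1 := by
  have h := A.det_coe
  rw [Matrix.det_fin_two] at h
  exact_mod_cast congrArg (Int.cast : ℤ → R) h

theorem entries_mul_S (A : SL(2, ℤ)) :
    (A * ModularGroup.S) 0 0 = A 0 1 ∧ (A * ModularGroup.S) 0 1 = - A 0 0 ∧
      (A * ModularGroup.S) 1 0 = A 1 1 ∧ (A * ModularGroup.S) 1 1 = - A 1 0 := by
  simp [ModularGroup.coe_S, Matrix.mul_apply, Fin.sum_univ_two]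

theorem entries_mul_T (A : SL(2, ℤ)) :
    (A * ModularGroup.T) 0 0 = A 0 0 ∧ (A * ModularGroup.T) 0 1 = A 0 0 + A 0 1 ∧
      (A * ModularGroup.T) 1 0 = A 1 0 ∧ (A * ModularGroup.T) 1 1 = A 1 0 + A 1 1 := by
  simp [ModularGroup.coe_T, Matrix.mul_apply, Fin.sum_univ_two]

theorem cubicForm_S : ∀ a b c d : ZMod 3, a * d - b * c = 1 →
    cubicForm b (-a) d (-c) = cubicForm a b c d + 0 := by
  unfold cubicForm; decide

theorem cubicForm_T : ∀ a b c d : ZMod 3, a * d - b * c = 1 →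
    cubicForm a (a + b) c (c + d) = cubicForm a b c d + 1 := by
  unfold cubicForm; decide

set_option maxRecDepth 4000 in
theorem quarticForm_S : ∀ a b c d : ZMod 4, a * d - b * c = 1 →
    quarticForm b (-a) d (-c) = quarticForm a b c d + 1 := by
  unfold quarticForm; decide

set_option maxRecDepth 4000 in
theorem quarticForm_T : ∀ a b c d : ZMod 4, a * d - b * c = 1 →
    quarticForm a (a + b) c (c + d) = quarticForm a b c d + 1 := by
  unfold quarticForm; decide

/-- The character of order three of `SL(2, ℤ)` with value `1` at `T`. -/
def cubicChar : SL(2, ℤ) →* Multiplicative (ZMod 3) where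
  toFun A := .ofAdd (cubicForm (A 0 0 : ℤ) (A 0 1 : ℤ) (A 1 0 : ℤ) (A 1 1 : ℤ))
  map_one' := by simp [cubicForm]
  map_mul' A B := by
    rw [← ofAdd_add]
    refine congrArg Multiplicative.ofAdd (map_mul_of_map_mul_generators (fun A : SL(2, ℤ) ↦
      cubicForm (A 0 0 : ℤ) (A 0 1 : ℤ) (A 1 0 : ℤ) (A 1 1 : ℤ)) 0 1 ?_ ?_ ?_ A B)
    · simp [cubicForm]
    · intro A
      obtain ⟨h1, h2, h3, h4⟩ := entries_mul_S A
      simp only [h1, h2, h3, h4, Int.cast_neg]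
      exact cubicForm_S _ _ _ _ (det_cast_eq_one A _)
    · intro A
      obtain ⟨h1, h2, h3, h4⟩ := entries_mul_T A
      simp only [h1, h2, h3, h4, Int.cast_add]
      exact cubicForm_T _ _ _ _ (det_cast_eq_one A _)

/-- The character of order four of `SL(2, ℤ)` with value `1` at `T`. -/
def quarticChar : SL(2, ℤ) →* Multiplicative (ZMod 4) where
  toFun A := .ofAdd (quarticForm (A 0 0 : ℤ) (A 0 1 : ℤ) (A 1 0 : ℤ) (A 1 1 : ℤ))
  map_one' := by simp [quarticForm]
  map_mul' A B := by
    rw [← ofAdd_add]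
    refine congrArg Multiplicative.ofAdd (map_mul_of_map_mul_generators (fun A : SL(2, ℤ) ↦
      quarticForm (A 0 0 : ℤ) (A 0 1 : ℤ) (A 1 0 : ℤ) (A 1 1 : ℤ)) 1 1 ?_ ?_ ?_ A B)
    · simp [quarticForm]
    · intro A
      obtain ⟨h1, h2, h3, h4⟩ := entries_mul_S A
      simp only [h1, h2, h3, h4, Int.cast_neg]
      exact quarticForm_S _ _ _ _ (det_cast_eq_one A _)
    · intro A
      obtain ⟨h1, h2, h3, h4⟩ := entries_mul_T A
      simp only [h1, h2, h3, h4, Int.cast_add]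
      exact quarticForm_T _ _ _ _ (det_cast_eq_one A _)

theorem cubicChar_T : cubicChar ModularGroup.T = .ofAdd 1 := by decide

theorem quarticChar_T : quarticChar ModularGroup.T = .ofAdd 1 := by decide

theorem cubicChar_neg (A : SL(2, ℤ)) : cubicChar (-A) = cubicChar A := by
  rw [← neg_one_mul, map_mul, show cubicChar (-1) = 1 by decide, one_mul]

theorem cubicChar_of_mem_Gamma {n : ℕ} (hn : 3 ∣ n) {A : SL(2, ℤ)}
    (hA : A ∈ CongruenceSubgroup.Gamma n) : cubicChar A = 1 := by
  obtain ⟨h1, h2, h3, h4⟩ := CongruenceSubgroup.Gamma_mem.mp (Gamma_mono hn hA)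
  simp [cubicChar, h1, h2, h3, h4, cubicForm]

theorem quarticChar_of_mem_Gamma {n : ℕ} (hn : 4 ∣ n) {A : SL(2, ℤ)}
    (hA : A ∈ CongruenceSubgroup.Gamma n) : quarticChar A = 1 := by
  obtain ⟨h1, h2, h3, h4⟩ := CongruenceSubgroup.Gamma_mem.mp (Gamma_mono hn hA)
  simp [quarticChar, h1, h2, h3, h4, quarticForm]

set_option maxRecDepth 4000 in
-- Twice the character of order four is the sign character of SL(2, ℤ/2) ≅ S₃, hence trivial on
-- Γ(2). The hypotheses express congruence to the identity modulo 2 inside ℤ/4.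
theorem two_mul_quarticForm : ∀ a b c d : ZMod 4, 2 * a = 2 → 2 * b = 0 → 2 * c = 0 → 2 * d = 2 →
    2 * quarticForm a b c d = 0 := by
  unfold quarticForm; decide

theorem two_mul_quarticChar_of_mem_Gamma {n : ℕ} (hn : 2 ∣ n) {A : SL(2, ℤ)}
    (hA : A ∈ CongruenceSubgroup.Gamma n) : 2 * (quarticChar A).toAdd = 0 := by
  obtain ⟨h1, h2, h3, h4⟩ := CongruenceSubgroup.Gamma_mem.mp (Gamma_mono hn hA)
  have aux0 : ∀ x : ℤ, ((x : ℤ) : ZMod 2) = 0 → (2 : ZMod 4) * (x : ℤ) = 0 := by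
    intro x hx
    obtain ⟨y, rfl⟩ := (ZMod.intCast_zmod_eq_zero_iff_dvd _ _).mp hx
    push_cast
    rw [← mul_assoc, show (2 : ZMod 4) * 2 = 0 by decide, zero_mul]
  have aux1 : ∀ x : ℤ, ((x : ℤ) : ZMod 2) = 1 → (2 : ZMod 4) * (x : ℤ) = 2 := by
    intro x hx
    have := aux0 (x - 1) (by push_cast; rw [hx, sub_self])
    push_cast at this
    rwa [mul_sub, sub_eq_zero, mul_one] at this
  exact two_mul_quarticForm _ _ _ _ (aux1 _ h1) (aux0 _ h2) (aux0 _ h3) (aux1 _ h4)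

/-! ### Homomorphisms that are central on a power of `T` -/

theorem prod_map_zpow_sub_mul {Q : Type*} [Group Q] {s t : Q} (n : ℕ) (h : Commute (t ^ n) s)
    (l : List ℤ) :
    (l.map fun a : ℤ ↦ t ^ (a - n) * s).prod =
      ((t ^ n) ^ l.length)⁻¹ * (l.map fun a : ℤ ↦ t ^ a * s).prod := by
  have ht : Commute (t ^ n) t := (Commute.refl t).pow_left n
  induction l with
  | nil => simp
  | cons a l ih =>
    have hc : Commute (t ^ a * s) ((t ^ n) ^ l.length)⁻¹ :=
      (((ht.zpow_right a).mul_right h).symm.pow_right l.length).inv_right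
    rw [List.map_cons, List.prod_cons, ih, List.map_cons, List.prod_cons, List.length_cons,
      pow_succ, mul_inv_rev, sub_eq_add_neg, add_comm, zpow_add, zpow_neg, zpow_natCast]
    calc (t ^ n)⁻¹ * t ^ a * s * (((t ^ n) ^ l.length)⁻¹ * (l.map fun a : ℤ ↦ t ^ a * s).prod)
        = (t ^ n)⁻¹ * ((t ^ a * s) * ((t ^ n) ^ l.length)⁻¹) *
          (l.map fun a : ℤ ↦ t ^ a * s).prod := by simp only [mul_assoc]
      _ = _ := by rw [hc.eq]; simp only [mul_assoc]

section

variable {G : Type*} [Group G] (F : SL(2, ℤ) →* G)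

/-- Both words are killed by `F`. Lowering every exponent by `n` changes the image by one central
factor `F(Tⁿ)⁻¹` per letter, so the power of `F(Tⁿ)` given by the length is trivial. -/
theorem map_T_pow_pow_length_eq_one (hneg : F (-1) = 1) {n : ℕ}
    (hz : ∀ g, Commute (F (ModularGroup.T ^ n)) (F g)) (l : List ℤ)
    (h1 : (l.map fun a : ℤ ↦ ModularGroup.T ^ a * ModularGroup.S).prod = 1 ∨
      (l.map fun a : ℤ ↦ ModularGroup.T ^ a * ModularGroup.S).prod = -1)
    (h2 : (l.map fun a : ℤ ↦ ModularGroup.T ^ (a - n) * ModularGroup.S).prod = 1 ∨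
      (l.map fun a : ℤ ↦ ModularGroup.T ^ (a - n) * ModularGroup.S).prod = -1) :
    F (ModularGroup.T ^ n) ^ l.length = 1 := by
  have hF : ∀ B : SL(2, ℤ), B = 1 ∨ B = -1 → F B = 1 := by
    rintro _ (rfl | rfl)
    exacts [map_one F, hneg]
  have h1' := hF _ h1
  have h2' := hF _ h2
  simp only [map_list_prod, List.map_map, Function.comp_def, map_mul, map_zpow] at h1' h2'
  rw [map_pow] at hz
  rw [prod_map_zpow_sub_mul n (hz _), h1', mul_one, inv_eq_one] at h2'
  rwa [map_pow]

theorem conj_map_eq_of_commute {F : SL(2, ℤ) →* G} {x : SL(2, ℤ)}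
    (hz : ∀ g, Commute (F x) (F g)) (g : SL(2, ℤ)) : F (g * x * g⁻¹) = F x := by
  rw [map_mul, map_mul, ← (hz g).eq, mul_assoc, ← map_mul, mul_inv_cancel, map_one, mul_one]

theorem cubicChar_T_pow (n : ℕ) : cubicChar (ModularGroup.T ^ n) = .ofAdd (n : ZMod 3) := by
  rw [map_pow, cubicChar_T, ← ofAdd_nsmul, nsmul_one]

theorem quarticChar_T_pow (n : ℕ) : quarticChar (ModularGroup.T ^ n) = .ofAdd (n : ZMod 4) := by
  rw [map_pow, quarticChar_T, ← ofAdd_nsmul, nsmul_one]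

/-- The exponent relation of an element with respect to conjugates of `Tⁿ`. -/
def HasExponent (n : ℕ) (A : SL(2, ℤ)) (k : ℤ) : Prop :=
  F A = F (ModularGroup.T ^ n) ^ k ∧ cubicChar A = .ofAdd ((n * k : ℤ) : ZMod 3) ∧
    quarticChar A = .ofAdd ((n * k : ℤ) : ZMod 4)

variable {F}

theorem HasExponent.one (n : ℕ) : HasExponent F n 1 0 := by simp [HasExponent]

theorem HasExponent.mul {n : ℕ} {A B : SL(2, ℤ)} {k l : ℤ} (hA : HasExponent F n A k)
    (hB : HasExponent F n B l) : HasExponent F n (A * B) (k + l) := by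
  refine ⟨by rw [map_mul, hA.1, hB.1, zpow_add], ?_, ?_⟩
  · rw [map_mul, hA.2.1, hB.2.1, ← ofAdd_add, mul_add, Int.cast_add]
  · rw [map_mul, hA.2.2, hB.2.2, ← ofAdd_add, mul_add, Int.cast_add]

theorem HasExponent.inv {n : ℕ} {A : SL(2, ℤ)} {k : ℤ} (hA : HasExponent F n A k) :
    HasExponent F n A⁻¹ (-k) := by
  refine ⟨by rw [map_inv, hA.1, zpow_neg], ?_, ?_⟩
  · rw [map_inv, hA.2.1, ← ofAdd_neg, mul_neg, Int.cast_neg]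
  · rw [map_inv, hA.2.2, ← ofAdd_neg, mul_neg, Int.cast_neg]

theorem HasExponent.conj {n : ℕ} (hz : ∀ g, Commute (F (ModularGroup.T ^ n)) (F g))
    (g : SL(2, ℤ)) : HasExponent F n (g * ModularGroup.T ^ n * g⁻¹) 1 := by
  refine ⟨by rw [conj_map_eq_of_commute hz, zpow_one], ?_, ?_⟩
  · rw [conj_map_eq_of_commute fun _ ↦ Commute.all _ _, cubicChar_T_pow]; simp
  · rw [conj_map_eq_of_commute fun _ ↦ Commute.all _ _, quarticChar_T_pow]; simp

theorem exists_hasExponent {n : ℕ} (hz : ∀ g, Commute (F (ModularGroup.T ^ n)) (F g))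
    {A : SL(2, ℤ)} (hA : A ∈ Subgroup.normalClosure {ModularGroup.T ^ n}) :
    ∃ k, HasExponent F n A k :=
  exists_exponent_of_mem_normalClosure (HasExponent F n) (.one n) (fun _ _ _ _ ↦ .mul)
    (fun _ _ ↦ .inv) (.conj hz) hA

theorem HasExponent.three_dvd {n N : ℕ} {A : SL(2, ℤ)} {k : ℤ} (h : HasExponent F n A k)
    (hA : A ∈ CongruenceSubgroup.Gamma N) (hN : 3 ∣ N) : (3 : ℤ) ∣ n * k := by
  have := h.2.1
  rw [cubicChar_of_mem_Gamma hN hA, eq_comm, ofAdd_eq_one] at this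
  exact (ZMod.intCast_zmod_eq_zero_iff_dvd _ _).mp this

theorem HasExponent.four_dvd {n N : ℕ} {A : SL(2, ℤ)} {k : ℤ} (h : HasExponent F n A k)
    (hA : A ∈ CongruenceSubgroup.Gamma N) (hN : 4 ∣ N) : (4 : ℤ) ∣ n * k := by
  have := h.2.2
  rw [quarticChar_of_mem_Gamma hN hA, eq_comm, ofAdd_eq_one] at this
  exact (ZMod.intCast_zmod_eq_zero_iff_dvd _ _).mp this

theorem HasExponent.four_dvd_two_mul {n N : ℕ} {A : SL(2, ℤ)} {k : ℤ}
    (h : HasExponent F n A k) (hA : A ∈ CongruenceSubgroup.Gamma N) (hN : 2 ∣ N) :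
    (4 : ℤ) ∣ 2 * (n * k) := by
  have := two_mul_quarticChar_of_mem_Gamma hN hA
  rw [h.2.2, toAdd_ofAdd] at this
  exact (ZMod.intCast_zmod_eq_zero_iff_dvd (2 * (n * k)) 4).mp (by push_cast at this ⊢; exact this)

/-! ### A parity character on Γ(4) modulo Γ(8) -/

/-- The exponent relation modulo 2 on `Γ(4)` given by `(a - 1 + b + c) / 4`. -/
def HasParity (A : SL(2, ℤ)) (k : ℤ) : Prop :=
  ∃ x y z w : ℤ, A 0 0 = 1 + 4 * x ∧ A 0 1 = 4 * y ∧ A 1 0 = 4 * z ∧ A 1 1 = 1 + 4 * w ∧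
    2 ∣ x + y + z - k

theorem HasParity.one : HasParity 1 0 := ⟨0, 0, 0, 0, by simp⟩

/-- Modulo 8 one has `(1 + 4X)(1 + 4Y) = 1 + 4(X + Y)`, so every linear form in `X` modulo 2 is
additive; here the form is `x + y + z`. -/
theorem HasParity.mul {A B : SL(2, ℤ)} {k l : ℤ} (hA : HasParity A k) (hB : HasParity B l) :
    HasParity (A * B) (k + l) := by
  obtain ⟨x, y, z, w, h1, h2, h3, h4, m, h5⟩ := hA
  obtain ⟨x', y', z', w', h1', h2', h3', h4', m', h5'⟩ := hB
  refine ⟨x + x' + 4 * (x * x' + y * z'), y + y' + 4 * (x * y' + y * w'),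
    z + z' + 4 * (z * x' + w * z'), w + w' + 4 * (z * y' + w * w'), ?_, ?_, ?_, ?_,
    m + m' + 2 * (x * x' + y * z') + 2 * (x * y' + y * w') + 2 * (z * x' + w * z'), ?_⟩
  all_goals try
    simp only [Matrix.SpecialLinearGroup.coe_mul, Matrix.mul_apply, Fin.sum_univ_two, h1, h2, h3,
      h4, h1', h2', h3', h4']
    ring
  linear_combination h5 + h5'

theorem HasParity.inv {A : SL(2, ℤ)} {k : ℤ} (hA : HasParity A k) : HasParity A⁻¹ (-k) := by
  obtain ⟨x, y, z, w, h1, h2, h3, h4, m, h5⟩ := hA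
  have hdet := det_cast_eq_one A ℤ
  simp only [h1, h2, h3, h4, Int.cast_id] at hdet
  -- The determinant gives `x + w + 4(xw - yz) = 0`, so `w` and `-x` agree modulo 4.
  refine ⟨w, -y, -z, x, ?_, ?_, ?_, ?_, -m - 2 * (x * w - y * z) + k - y - z + y + z - k, ?_⟩
  · simp [Matrix.SpecialLinearGroup.coe_inv, Matrix.adjugate_fin_two, h4]
  · simp [Matrix.SpecialLinearGroup.coe_inv, Matrix.adjugate_fin_two, h2]
  · simp [Matrix.SpecialLinearGroup.coe_inv, Matrix.adjugate_fin_two, h3]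
  · simp [Matrix.SpecialLinearGroup.coe_inv, Matrix.adjugate_fin_two, h1]
  · linarith

/-- If `(p, r)` is the first column of `g`, the conjugate is `1 + 4X` with first row `(-pr, p²)` and
second row `(-r², pr)` in `X`. The form `-pr + p² - r²` is odd because determinant 1 prevents `p`
and `r` from both being even. -/
theorem HasParity.conj (g : SL(2, ℤ)) : HasParity (g * ModularGroup.T ^ 4 * g⁻¹) 1 := by
  have hdet := det_cast_eq_one g ℤ
  simp only [Int.cast_id] at hdet
  have hT : ((ModularGroup.T ^ 4 : SL(2, ℤ)) : Matrix (Fin 2) (Fin 2) ℤ) = !![1, 4; 0, 1] := by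
    decide
  have hpar : (2 : ℤ) ∣ -(g 0 0 * g 1 0) + g 0 0 * g 0 0 + -(g 1 0 * g 1 0) - 1 := by
    generalize g 0 0 = p at *
    generalize g 1 0 = r at *
    generalize g 0 1 = q at *
    generalize g 1 1 = s at *
    rcases Int.even_or_odd' p with ⟨p, rfl | rfl⟩ <;> rcases Int.even_or_odd' r with ⟨r, rfl | rfl⟩
    · exfalso
      have : 2 * (p * s - q * r) = 1 := by linear_combination hdet
      omega
    · exact ⟨-(p * (2 * r + 1)) + 2 * p * p - (2 * r * r + 2 * r + 1), by ring⟩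
    · exact ⟨-((2 * p + 1) * r) + (2 * p * p + 2 * p) - 2 * r * r, by ring⟩
    · exact ⟨-(2 * p * r + p + r + 1) + (2 * p * p + 2 * p) - (2 * r * r + 2 * r), by ring⟩
  refine ⟨-(g 0 0 * g 1 0), g 0 0 * g 0 0, -(g 1 0 * g 1 0), g 0 0 * g 1 0, ?_, ?_, ?_, ?_, hpar⟩
  all_goals
    simp only [Matrix.SpecialLinearGroup.coe_mul, Matrix.SpecialLinearGroup.coe_inv, hT,
      Matrix.adjugate_fin_two, Matrix.mul_apply, Fin.sum_univ_two, Matrix.of_apply,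
      Matrix.cons_val', Matrix.cons_val_zero, Matrix.cons_val_one, Matrix.cons_val_fin_one]
  · linear_combination hdet
  · ring
  · ring
  · linear_combination hdet

theorem HasParity.two_dvd {N : ℕ} {A : SL(2, ℤ)} {k : ℤ} (h : HasParity A k)
    (hA : A ∈ CongruenceSubgroup.Gamma N) (hN : 8 ∣ N) : (2 : ℤ) ∣ k := by
  obtain ⟨x, y, z, w, h1, h2, h3, h4, h5⟩ := h
  obtain ⟨h1', h2', h3', -⟩ := CongruenceSubgroup.Gamma_mem.mp (Gamma_mono hN hA)
  rw [h1] at h1'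
  rw [h2] at h2'
  rw [h3] at h3'
  have h1' : ((4 * x : ℤ) : ZMod 8) = 0 := by
    push_cast at h1' ⊢
    simpa using h1'
  have h1'' := (ZMod.intCast_zmod_eq_zero_iff_dvd _ _).mp h1'
  have h2'' := (ZMod.intCast_zmod_eq_zero_iff_dvd _ _).mp h2'
  have h3'' := (ZMod.intCast_zmod_eq_zero_iff_dvd _ _).mp h3'
  push_cast at h1'' h2'' h3''
  omega

theorem exists_hasExponent_hasParity (hz : ∀ g, Commute (F (ModularGroup.T ^ 4)) (F g))
    {A : SL(2, ℤ)} (hA : A ∈ Subgroup.normalClosure {ModularGroup.T ^ 4}) :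
    ∃ k, HasExponent F 4 A k ∧ HasParity A k :=
  exists_exponent_of_mem_normalClosure (fun A k ↦ HasExponent F 4 A k ∧ HasParity A k)
    ⟨.one 4, .one⟩ (fun _ _ _ _ h h' ↦ ⟨h.1.mul h'.1, h.2.mul h'.2⟩)
    (fun _ _ h ↦ ⟨h.1.inv, h.2.inv⟩) (fun g ↦ ⟨.conj hz g, .conj g⟩) hA

/-- If the image of `Tⁿ` is central, `2 ≤ n ≤ 5`, then the kernel is a congruence subgroup. -/
theorem map_eq_one_of_mem_Gamma (hneg : F (-1) = 1) {n : ℕ} (h2 : 2 ≤ n) (h5 : n ≤ 5)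
    (hz : ∀ g, Commute (F (ModularGroup.T ^ n)) (F g)) {A : SL(2, ℤ)}
    (hA : A ∈ CongruenceSubgroup.Gamma (n * orderOf (F (ModularGroup.T ^ n)))) : F A = 1 := by
  have hAn := Gamma_mono (Dvd.intro _ rfl) hA
  have hword := map_T_pow_pow_length_eq_one F hneg hz
  have hdvd : ∀ {c : ℕ}, F (ModularGroup.T ^ n) ^ c = 1 → orderOf (F (ModularGroup.T ^ n)) ∣ c :=
    fun h ↦ orderOf_dvd_of_pow_eq_one h
  have hfin : ∀ {B : SL(2, ℤ)} {k : ℤ}, HasExponent F n B k →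
      (orderOf (F (ModularGroup.T ^ n)) : ℤ) ∣ k → F B = 1 :=
    fun hB hk ↦ by rw [hB.1, orderOf_dvd_iff_zpow_eq_one.mp hk]
  generalize orderOf (F (ModularGroup.T ^ n)) = m at *
  interval_cases n
  -- The lists here and below count the triangles at the vertices of a triangulated polygon with 3,
  -- 4, 6 or 12 vertices, which makes the product of the `T^a S` equal to ±1. Each is chosen so that
  -- `a ↦ n - a` reverses it; the shifted word is then trivial up to sign as well.
  · have hm : m ∣ 3 := hdvd (hword [1, 1, 1] (by decide) (by decide))
    obtain ⟨B, hB, hAB⟩ := exists_mem_normalClosure_of_mem_Gamma h2 h5 hAn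
    obtain ⟨k, hk⟩ := exists_hasExponent hz hB
    have hA' : HasExponent F 2 A k ∨ HasExponent F 2 (-A) k := by
      rcases hAB with rfl | rfl
      exacts [.inl hk, .inr (by rwa [neg_neg])]
    have hFA : F A = F B := by
      rcases hAB with rfl | rfl
      · rfl
      · rw [← neg_one_mul, map_mul, hneg, one_mul]
    -- For `n = 2` only `±A` lies in the normal closure. The cubic character does not see the sign,
    -- and it suffices because `m` is 1 or 3.
    have hc : cubicChar A = cubicChar B := by
      rcases hAB with rfl | rfl
      exacts [rfl, cubicChar_neg B]
    rw [hFA]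
    refine hfin hk ?_
    rcases (Nat.dvd_prime Nat.prime_three).mp hm with rfl | rfl
    · simp
    · rw [cubicChar_of_mem_Gamma ⟨2, rfl⟩ hA] at hc
      have := hk.2.1
      rw [← hc, eq_comm, ofAdd_eq_one, ZMod.intCast_zmod_eq_zero_iff_dvd] at this
      omega
  · have hm : m ∣ 4 := hdvd (hword [1, 2, 1, 2] (by decide) (by decide))
    obtain ⟨k, hk⟩ := exists_hasExponent hz (mem_normalClosure_of_mem_Gamma (by norm_num) h5 hAn)
    refine hfin hk ?_
    have h4 := hk.four_dvd hA
    have h2 := hk.four_dvd_two_mul hA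
    have := Nat.le_of_dvd (by norm_num) hm
    interval_cases m <;> omega
  · have hm : m ∣ 6 := hdvd (hword [1, 3, 1, 3, 1, 3] (by decide) (by decide))
    obtain ⟨k, hk, hk'⟩ := exists_hasExponent_hasParity hz
      (mem_normalClosure_of_mem_Gamma (by norm_num) h5 hAn)
    refine hfin hk ?_
    have h3 := hk.three_dvd hA
    -- The quartic character vanishes on `T⁴` and gives nothing here. If `m` is even then 8 divides
    -- `4m`, and the parity character applies.
    have h2 := hk'.two_dvd hA
    have := Nat.le_of_dvd (by norm_num) hm
    interval_cases m <;> omega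
  · have hm : m ∣ 12 := hdvd (hword [1, 2, 2, 3, 3, 4, 1, 2, 2, 3, 3, 4] (by decide) (by decide))
    obtain ⟨k, hk⟩ := exists_hasExponent hz (mem_normalClosure_of_mem_Gamma (by norm_num) h5 hAn)
    refine hfin hk ?_
    have h3 := hk.three_dvd hA
    have h4 := hk.four_dvd hA
    have h2 := hk.four_dvd_two_mul hA
    have := Nat.le_of_dvd (by norm_num) hm
    interval_cases m <;> omega

end

theorem mk_modular_neg_one : (QuotientGroup.mk (-1 : SL(2, ℤ)) : PSL(2, ℤ)) = 1 :=
  (QuotientGroup.eq_one_iff _).mpr ((mem_center_SL2Z_iff _).mpr (.inr rfl))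

/-- A homomorphism on `PSL(2, ℤ)` with central image of `Tⁿ`, where `2 ≤ n ≤ 5` divides the order
`N` of the image of `T`, is trivial on `Γ(N)`. -/
theorem principalPSL_orderOf_le_ker {G : Type*} [Group G] (f : PSL(2, ℤ) →* G) {n : ℕ}
    (h2 : 2 ≤ n) (h5 : n ≤ 5) (hz : ∀ g, Commute (f modT ^ n) (f g))
    (hn : n ∣ orderOf (f modT)) : principalPSL (orderOf (f modT)) ≤ f.ker := by
  rintro _ ⟨A, hA, rfl⟩
  have hT : (f.comp (QuotientGroup.mk' (Subgroup.center SL(2, ℤ)))) (ModularGroup.T ^ n) =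
      f modT ^ n := map_pow _ _ _
  refine map_eq_one_of_mem_Gamma (F := f.comp (QuotientGroup.mk' (Subgroup.center SL(2, ℤ))))
    ?_ h2 h5 ?_ (A := A) ?_
  · exact (congrArg f mk_modular_neg_one).trans (map_one f)
  · intro g
    rw [hT]
    exact hz _
  · rw [hT, orderOf_pow_of_dvd (by omega) hn, Nat.mul_div_cancel' hn]
    exact hA

/-! ### The kernel of the projection from the braid group to the modular group -/

section NormalForm

variable {Q : Type*} [Group Q]

/-- The value of a positive word in `t` and `s t⁻¹ s`. -/
def positiveWord (s t : Q) (l : List Bool) : Q :=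
  (l.map fun b ↦ if b then t else s * t⁻¹ * s).prod

theorem positiveWord_true (s t : Q) (l : List Bool) :
    positiveWord s t (true :: l) = t * positiveWord s t l := by simp [positiveWord]

theorem positiveWord_false (s t : Q) (l : List Bool) :
    positiveWord s t (false :: l) = s * t⁻¹ * s * positiveWord s t l := by simp [positiveWord]

/-- Normal form in a group generated by `s` and `t` with `s² = (t s)³ = 1`. -/
theorem exists_normalForm {s t : Q} (hs : s * s = 1) (hts : (t * s) ^ 3 = 1) {x : Q}
    (hx : x ∈ Subgroup.closure {s, t}) :
    ∃ e < 2, ∃ l, ∃ i < 3, x = s ^ e * positiveWord s t l * (t * s) ^ i := by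
  set P : Q → Prop := fun x ↦
    ∃ e < 2, ∃ l, ∃ i < 3, x = s ^ e * positiveWord s t l * (t * s) ^ i with hP
  have hsi : s⁻¹ = s := inv_eq_of_mul_eq_one_left hs
  have hri : (t * s)⁻¹ = t * s * (t * s) := by
    rw [inv_eq_iff_mul_eq_one, ← hts]; simp only [pow_succ, pow_zero, one_mul, mul_assoc]
  have hPs : ∀ x, P x → P (s * x) := by
    rintro _ ⟨e, he, l, i, hi, rfl⟩
    interval_cases e
    · exact ⟨1, by norm_num, l, i, hi, by simp [mul_assoc]⟩
    · exact ⟨0, by norm_num, l, i, hi, by simp [← mul_assoc, hs]⟩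
  have hPr : ∀ x, P x → P (t * s * x) := by
    rintro _ ⟨e, he, l, i, hi, rfl⟩
    interval_cases e
    · match l with
      | [] =>
        interval_cases i
        · exact ⟨0, by norm_num, [], 1, by norm_num, by simp [positiveWord]⟩
        · exact ⟨0, by norm_num, [], 2, by norm_num, by simp [positiveWord, pow_two]⟩
        · exact ⟨0, by norm_num, [], 0, by norm_num, by
            simpa [positiveWord, pow_succ, mul_assoc] using hts⟩
      | true :: l =>
        refine ⟨0, by norm_num, false :: l, i, hi, ?_⟩
        have : t * s * t = s * t⁻¹ * s := by
          calc t * s * t = (t * s * (t * s)) * s⁻¹ := by group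
            _ = _ := by rw [← hri, hsi, mul_inv_rev, hsi]
        rw [positiveWord_true, positiveWord_false, ← this]
        simp only [pow_zero, one_mul, mul_assoc]
      | false :: l =>
        refine ⟨1, by norm_num, l, i, hi, ?_⟩
        have : t * s * (s * t⁻¹ * s) = s := by
          rw [show t * s * (s * t⁻¹ * s) = t * (s * s) * t⁻¹ * s by simp only [mul_assoc], hs]
          group
        rw [positiveWord_false, pow_zero, one_mul, pow_one]
        rw [← mul_assoc, ← mul_assoc, this]
    · refine ⟨0, by norm_num, true :: l, i, hi, ?_⟩
      rw [positiveWord_true]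
      simp only [pow_zero, one_mul, pow_one, ← mul_assoc]
      rw [mul_assoc t s s, hs, mul_one]
  have hP1 : P 1 := ⟨0, by norm_num, [], 0, by norm_num, by simp [positiveWord]⟩
  change P x
  induction hx using Subgroup.closure_induction_left with
  | one => exact hP1
  | mul_left y hy x hx ih =>
    rcases hy with rfl | rfl
    · exact hPs _ ih
    · rw [show y * x = y * s * (s * x) by rw [← mul_assoc, mul_assoc y, hs, mul_one]]
      exact hPr _ (hPs _ ih)
  | inv_mul_cancel y hy x hx ih =>
    rcases hy with rfl | rfl
    · rw [hsi]; exact hPs _ ih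
    · rw [show y⁻¹ * x = s * (y * s * (y * s * x)) by
        rw [← mul_assoc (y * s), ← hri, mul_inv_rev, hsi, ← mul_assoc, ← mul_assoc, hs, one_mul]]
      exact hPs _ (hPr _ (hPr _ ih))

theorem map_positiveWord {Q' : Type*} [Group Q'] (p : Q →* Q') (s t : Q) (l : List Bool) :
    p (positiveWord s t l) = positiveWord (p s) (p t) l := by
  simp only [positiveWord, map_list_prod, List.map_map]
  congr 1
  refine List.map_congr_left fun b _ ↦ ?_
  cases b <;> simp

end NormalForm

/-- The product of matrices `T` and `U` given by a word. -/
def positiveMatrix (l : List Bool) : SL(2, ℤ) :=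
  (l.map fun b ↦ if b then ModularGroup.T else matU).prod

theorem mk_positiveMatrix (l : List Bool) :
    (QuotientGroup.mk (positiveMatrix l) : PSL(2, ℤ)) =
      positiveWord (QuotientGroup.mk ModularGroup.S) modT l := by
  have h := map_list_prod (QuotientGroup.mk' (Subgroup.center SL(2, ℤ)))
    (l.map fun b ↦ if b then ModularGroup.T else matU)
  refine h.trans ?_
  rw [positiveWord, List.map_map]
  congr 1
  refine List.map_congr_left fun b _ ↦ ?_
  cases b
  · refine QuotientGroup.eq.mpr ((mem_center_SL2Z_iff _).mpr (.inr ?_))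
    decide
  · rfl

/-- Left multiplication by `T` or `U` only adds one row to the other, so entries never decrease, and
a nonempty word has a positive entry off the diagonal. -/
theorem positiveMatrix_entries (l : List Bool) :
    1 ≤ positiveMatrix l 0 0 ∧ 0 ≤ positiveMatrix l 0 1 ∧ 0 ≤ positiveMatrix l 1 0 ∧
      1 ≤ positiveMatrix l 1 1 ∧ (l ≠ [] → 1 ≤ positiveMatrix l 0 1 + positiveMatrix l 1 0) := by
  induction l with
  | nil => simp [positiveMatrix]
  | cons b l ih =>
    obtain ⟨h1, h2, h3, h4, -⟩ := ih
    cases b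
    · have : positiveMatrix (false :: l) = matU * positiveMatrix l := by simp [positiveMatrix]
      rw [this]
      rw [Matrix.SpecialLinearGroup.coe_mul, show (matU : Matrix (Fin 2) (Fin 2) ℤ) =
        !![1, 0; 1, 1] from rfl]
      simp [Matrix.mul_apply, Fin.sum_univ_two]
      omega
    · have : positiveMatrix (true :: l) = ModularGroup.T * positiveMatrix l := by
        simp [positiveMatrix]
      rw [this]
      simp [ModularGroup.coe_T, Matrix.mul_apply, Fin.sum_univ_two]
      omega

/-- The central matrices ±1 are diagonal, whereas by positivity some off-diagonal entry is nonzero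
for every normal form but the empty one. This gives uniqueness of the trivial normal form, and so
the presentation of PSL(2, ℤ). -/
theorem normalForm_trivial {e i : ℕ} (he : e < 2) (hi : i < 3) (l : List Bool)
    (h : (QuotientGroup.mk (ModularGroup.S ^ e * positiveMatrix l *
      (ModularGroup.T * ModularGroup.S) ^ i) : PSL(2, ℤ)) = 1) : e = 0 ∧ i = 0 ∧ l = [] := by
  rw [QuotientGroup.eq_one_iff, mem_center_SL2Z_iff] at h
  have h01 : (ModularGroup.S ^ e * positiveMatrix l *
      (ModularGroup.T * ModularGroup.S) ^ i) 0 1 = 0 := by rcases h with h | h <;> rw [h] <;> simp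
  have h10 : (ModularGroup.S ^ e * positiveMatrix l *
      (ModularGroup.T * ModularGroup.S) ^ i) 1 0 = 0 := by rcases h with h | h <;> rw [h] <;> simp
  obtain ⟨h1, h2, h3, h4, h5⟩ := positiveMatrix_entries l
  interval_cases e <;> interval_cases i <;>
    simp [ModularGroup.coe_T, ModularGroup.coe_S, Matrix.mul_apply, Fin.sum_univ_two, pow_two,
      Matrix.vecMul, dotProduct] at h01 h10 <;> try omega
  refine ⟨rfl, rfl, ?_⟩
  by_contra hl
  have := h5 hl
  omega

/-! ### The braid group -/

theorem braid_relation : braidσ₁ * braidσ₂ * braidσ₁ = braidσ₂ * braidσ₁ * braidσ₂ := by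
  have h := PresentedGroup.one_of_mem (rels := braidRels) (Set.mem_singleton _)
  rw [map_mul, map_inv, mul_inv_eq_one] at h
  simp only [map_mul] at h
  exact h

theorem braid_closure : Subgroup.closure {braidσ₁, braidσ₂} = ⊤ := by
  rw [← PresentedGroup.closure_range_of braidRels]
  congr 1
  ext x
  simp [braidσ₁, braidσ₂, Fin.exists_fin_two, eq_comm]

theorem braidProj_σ₁ : braidProj braidσ₁ = modT := by
  simp [braidProj, braidσ₁]

theorem braidProj_σ₂ : braidProj braidσ₂ = modU⁻¹ := by
  simp [braidProj, braidσ₂]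

theorem braidProj_halfTwist :
    braidProj (braidσ₁ * braidσ₂ * braidσ₁) = QuotientGroup.mk ModularGroup.S := by
  rw [map_mul, map_mul, braidProj_σ₁, braidProj_σ₂]
  refine QuotientGroup.eq.mpr ((mem_center_SL2Z_iff _).mpr (.inr ?_))
  decide

theorem braidProj_surjective : Function.Surjective braidProj := by
  rw [← MonoidHom.range_eq_top, eq_top_iff]
  rintro ⟨A⟩ -
  have h := mem_closure_S_T_image (QuotientGroup.mk' (Subgroup.center SL(2, ℤ))) A
  refine (Subgroup.closure_le _).mpr ?_ h
  rintro _ (rfl | rfl)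
  exacts [⟨_, braidProj_halfTwist⟩, ⟨_, braidProj_σ₁⟩]

theorem halfTwist_sq {Q : Type*} [Group Q] {a b : Q} (h : a * b * a = b * a * b) :
    a * b * a * (a * b * a) = (a * b) ^ 3 := by
  nth_rewrite 2 [h]
  simp only [pow_succ, pow_zero, one_mul, mul_assoc]

theorem mul_halfTwist {Q : Type*} [Group Q] {a b : Q} (h : a * b * a = b * a * b) :
    a * (a * b * a) = a * b * a * b := by
  nth_rewrite 1 [h]
  simp only [mul_assoc]

/-- A homomorphism on the braid group that kills the full twist factors through `PSL(2, ℤ)`. -/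
theorem braidProj_ker_le_ker {G : Type*} [Group G] (f : BraidGroup3 →* G)
    (hf : f ((braidσ₁ * braidσ₂) ^ 3) = 1) : braidProj.ker ≤ f.ker := by
  intro g hg
  -- In the product both components kill the full twist, so the image of `F` satisfies `s² = (ts)³ =
  -- 1` and has normal forms. If `π(g) = 1`, the second component forces the form of `F g` to be
  -- empty, so the first component is trivial too.
  set F := f.prod braidProj
  have hS := braidProj_halfTwist
  have hrel := congrArg F braid_relation
  simp only [map_mul] at hrel
  have htwist : (F braidσ₁ * F braidσ₂) ^ 3 = 1 := by
    rw [← map_mul, ← map_pow]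
    refine Prod.ext hf ?_
    change braidProj _ = 1
    rw [← halfTwist_sq braid_relation, map_mul, hS]
    exact mk_modular_neg_one ▸ (congrArg (QuotientGroup.mk' (Subgroup.center SL(2, ℤ)))
      modularS_mul_S)
  have hss := (halfTwist_sq hrel).trans htwist
  have hts : (F braidσ₁ * (F braidσ₁ * F braidσ₂ * F braidσ₁)) ^ 3 = 1 := by
    have h1 := mul_halfTwist hrel
    set a := F braidσ₁
    set b := F braidσ₂
    set s := a * b * a with hs
    have h2 : a * s * (a * s) = a * b := by
      nth_rewrite 2 [h1]
      rw [show a * s * (s * b) = a * (s * s) * b by simp only [mul_assoc], hss, mul_one]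
    rw [pow_succ, pow_two, h2, show a * b * (a * s) = s * s by rw [hs]; simp only [mul_assoc], hss]
  have hcl : F g ∈ Subgroup.closure {F braidσ₁ * F braidσ₂ * F braidσ₁, F braidσ₁} := by
    have hg : F g ∈ Subgroup.closure {F braidσ₁, F braidσ₂} := by
      rw [← Set.image_pair, ← MonoidHom.map_closure, braid_closure]
      exact ⟨g, trivial, rfl⟩
    refine (Subgroup.closure_le _).mpr ?_ hg
    have hmem : F braidσ₁ ∈ Subgroup.closure {F braidσ₁ * F braidσ₂ * F braidσ₁, F braidσ₁} :=
      Subgroup.subset_closure (by simp)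
    rintro _ (rfl | rfl)
    · exact hmem
    · have hmem' : F braidσ₁ * F braidσ₂ * F braidσ₁ ∈
        Subgroup.closure {F braidσ₁ * F braidσ₂ * F braidσ₁, F braidσ₁} :=
        Subgroup.subset_closure (by simp)
      have := mul_mem (mul_mem (inv_mem hmem) hmem') (inv_mem hmem)
      rwa [show ∀ a b : G × PSL(2, ℤ), a⁻¹ * (a * b * a) * a⁻¹ = b from fun a b ↦ by group] at this
  obtain ⟨e, he, l, i, hi, h⟩ := exists_normalForm hss hts hcl
  have hproj := congrArg (MonoidHom.snd G PSL(2, ℤ)) h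
  have hS' : MonoidHom.snd G PSL(2, ℤ) (F braidσ₁ * F braidσ₂ * F braidσ₁) =
      QuotientGroup.mk ModularGroup.S := by rw [← map_mul, ← map_mul]; exact hS
  have hT' : MonoidHom.snd G PSL(2, ℤ) (F braidσ₁) = modT := braidProj_σ₁
  rw [map_mul, map_mul, map_pow, map_positiveWord, map_pow, map_mul _ (F braidσ₁), hS', hT',
    ← mk_positiveMatrix] at hproj
  have hg' : MonoidHom.snd G PSL(2, ℤ) (F g) = 1 := hg
  obtain ⟨rfl, rfl, rfl⟩ := normalForm_trivial he hi l (hproj.symm.trans hg')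
  simp only [positiveWord, pow_zero, List.map_nil, List.prod_nil, mul_one] at h
  exact congrArg Prod.fst h

theorem exists_factor_braidProj {G : Type*} [Group G] (f : BraidGroup3 →* G)
    (hf : f ((braidσ₁ * braidσ₂) ^ 3) = 1) : ∃ g : PSL(2, ℤ) →* G, f = g.comp braidProj :=
  ⟨braidProj.liftOfSurjective braidProj_surjective ⟨f, braidProj_ker_le_ker f hf⟩,
    (braidProj.liftOfRightInverse_comp _ (Function.rightInverse_surjInv braidProj_surjective)
      ⟨f, braidProj_ker_le_ker f hf⟩).symm⟩

/-! ### Eigenvalues of matrices of finite order -/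

theorem exists_mulVec_eq_of_hasEigenvalue {d : ℕ} {A : Matrix (Fin d) (Fin d) ℂ} {a : ℂ}
    (h : Module.End.HasEigenvalue (Matrix.toLin' A) a) : ∃ v ≠ 0, A.mulVec v = a • v := by
  obtain ⟨v, hv⟩ := h.exists_hasEigenvector
  exact ⟨v, hv.2, by simpa using hv.apply_eq_smul⟩

theorem hasEigenvalue_of_mulVec_eq {d : ℕ} {A : Matrix (Fin d) (Fin d) ℂ} {a : ℂ}
    {v : Fin d → ℂ} (hv : v ≠ 0) (h : A.mulVec v = a • v) :
    Module.End.HasEigenvalue (Matrix.toLin' A) a :=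
  Module.End.hasEigenvalue_of_hasEigenvector
    ⟨Module.End.mem_eigenspace_iff.mpr (by simpa using h), hv⟩

theorem exists_hasEigenvalue {d : ℕ} (hd : 0 < d) (A : Matrix (Fin d) (Fin d) ℂ) :
    ∃ a, Module.End.HasEigenvalue (Matrix.toLin' A) a := by
  have : Nonempty (Fin d) := ⟨⟨0, hd⟩⟩
  exact Module.End.exists_eigenvalue _

theorem pow_mulVec_eq {d : ℕ} {A : Matrix (Fin d) (Fin d) ℂ} {a : ℂ} {v : Fin d → ℂ}
    (h : A.mulVec v = a • v) (t : ℕ) : (A ^ t).mulVec v = a ^ t • v := by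
  induction t with
  | zero => simp
  | succ t ih =>
    rw [pow_succ, ← Matrix.mulVec_mulVec, h, Matrix.mulVec_smul, ih, smul_smul, pow_succ']

theorem eigenvalue_pow_eq_one {d N : ℕ} {A : Matrix (Fin d) (Fin d) ℂ} (hA : A ^ N = 1) {a : ℂ}
    (h : Module.End.HasEigenvalue (Matrix.toLin' A) a) : a ^ N = 1 := by
  obtain ⟨v, hv, h⟩ := exists_mulVec_eq_of_hasEigenvalue h
  have := pow_mulVec_eq h N
  rw [hA, Matrix.one_mulVec] at this
  exact (smul_left_injective ℂ hv (by simpa using this)).symm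

/-- A power of a matrix of finite order is scalar if that power of its eigenvalues is constant. -/
theorem pow_eq_smul_one_of_eigenvalues {d N : ℕ} (hN : 0 < N) {A : Matrix (Fin d) (Fin d) ℂ}
    (hA : A ^ N = 1) {t : ℕ} {c : ℂ}
    (h : ∀ a, Module.End.HasEigenvalue (Matrix.toLin' A) a → a ^ t = c) :
    A ^ t = c • (1 : Matrix (Fin d) (Fin d) ℂ) := by
  -- `A` is annihilated by `X^N - 1`, which is separable in characteristic 0; hence `A` is
  -- diagonalizable.
  have hss : Module.End.IsSemisimple (Matrix.toLin' A) := by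
    refine Module.End.isSemisimple_of_squarefree_aeval_eq_zero
      (p := (Polynomial.X ^ N - 1 : Polynomial ℂ)) ?_ ?_
    · exact (Polynomial.separable_X_pow_sub_C (1 : ℂ) (by exact_mod_cast hN.ne')
        one_ne_zero).squarefree
    · simp [← Matrix.toLin'_pow, hA, Module.End.one_eq_id]
  have htop := hss.iSup_eigenspace_eq_top
  apply Matrix.toLin'.injective
  have hle : ⨆ a : ℂ, Module.End.eigenspace (Matrix.toLin' A) a ≤
      LinearMap.eqLocus (Matrix.toLin' (A ^ t)) (Matrix.toLin' (c • 1)) := by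
    refine iSup_le fun a v hv ↦ ?_
    by_cases hv0 : v = 0
    · simp [hv0]
    have hva : A.mulVec v = a • v := by simpa using Module.End.mem_eigenspace_iff.mp hv
    have := pow_mulVec_eq hva t
    rw [h a (hasEigenvalue_of_mulVec_eq hv0 hva)] at this
    rw [LinearMap.mem_eqLocus, Matrix.toLin'_apply, Matrix.toLin'_apply, this,
      Matrix.smul_mulVec, Matrix.one_mulVec]
  rw [htop] at hle
  ext1 v
  exact LinearMap.mem_eqLocus.mp (hle (Submodule.mem_top (x := Pi.single v 1))) |> fun h ↦ by
    ext
    simpa using congrFun h _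

theorem exists_projOrder_eq {d : ℕ} {A : Matrix (Fin d) (Fin d) ℂ} (h : projOrder A ≤ 5) :
    ∃ t : ℕ, 2 ≤ t ∧ t ≤ 5 ∧ (∀ a b : ℂ, Module.End.HasEigenvalue (Matrix.toLin' A) a →
      Module.End.HasEigenvalue (Matrix.toLin' A) b → a ^ t = b ^ t) ∧
      ∀ s : ℕ, 1 < s → (∀ a b : ℂ, Module.End.HasEigenvalue (Matrix.toLin' A) a →
      Module.End.HasEigenvalue (Matrix.toLin' A) b → a ^ s = b ^ s) → t ≤ s := by
  have hne : {s : ℕ∞ | ∃ t : ℕ, s = t ∧ 1 < t ∧ ∀ a b : ℂ,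
    Module.End.HasEigenvalue (Matrix.toLin' A) a →
    Module.End.HasEigenvalue (Matrix.toLin' A) b → a ^ t = b ^ t}.Nonempty := by
    by_contra hne
    rw [Set.not_nonempty_iff_eq_empty] at hne
    rw [projOrder, hne, sInf_empty] at h
    exact absurd h (by decide)
  obtain ⟨t, ht, h1, h2⟩ := csInf_mem hne
  refine ⟨t, h1, ?_, h2, fun s hs hs' ↦ ?_⟩
  · rw [projOrder, ht] at h
    exact_mod_cast h
  · have : projOrder A ≤ s := sInf_le ⟨s, rfl, hs, hs'⟩
    rw [projOrder, ht] at this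
    exact_mod_cast this

theorem projOrder_le {d : ℕ} {A : Matrix (Fin d) (Fin d) ℂ} {t : ℕ} (ht : 1 < t)
    (h : ∀ a b : ℂ, Module.End.HasEigenvalue (Matrix.toLin' A) a →
      Module.End.HasEigenvalue (Matrix.toLin' A) b → a ^ t = b ^ t) : projOrder A ≤ t :=
  sInf_le ⟨t, rfl, ht, h⟩

theorem projOrder_smul_le {d : ℕ} (A : Matrix (Fin d) (Fin d) ℂ) {c : ℂ} (hc : c ≠ 0) :
    projOrder (c • A) ≤ projOrder A := by
  refine sInf_le_sInf ?_
  rintro _ ⟨t, rfl, ht, h⟩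
  refine ⟨t, rfl, ht, fun a b ha hb ↦ ?_⟩
  have key : ∀ a, Module.End.HasEigenvalue (Matrix.toLin' (c • A)) a →
      Module.End.HasEigenvalue (Matrix.toLin' A) (c⁻¹ * a) := by
    intro a ha
    obtain ⟨v, hv, hva⟩ := exists_mulVec_eq_of_hasEigenvalue ha
    refine hasEigenvalue_of_mulVec_eq hv ?_
    rw [mul_smul, ← hva, Matrix.smul_mulVec, smul_smul, inv_mul_cancel₀ hc, one_smul]
  have := h _ _ (key a ha) (key b hb)
  rw [mul_pow, mul_pow] at this
  exact mul_left_cancel₀ (pow_ne_zero t (inv_ne_zero hc)) this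

/-! ### The congruence property of a representation of the modular group -/

theorem modT_pow_mem_principalPSL (n : ℕ) : modT ^ n ∈ principalPSL n :=
  ⟨ModularGroup.T ^ n, modularT_pow_mem_Gamma n, map_pow _ _ _⟩

theorem finiteIndex_principalPSL {n : ℕ} (hn : 0 < n) : (principalPSL n).FiniteIndex := by
  have : NeZero n := ⟨hn.ne'⟩
  refine ⟨fun h ↦ ?_⟩
  have := Subgroup.index_map_dvd (CongruenceSubgroup.Gamma n)
    (QuotientGroup.mk'_surjective (Subgroup.center SL(2, ℤ)))
  rw [show (CongruenceSubgroup.Gamma n).map (QuotientGroup.mk' (Subgroup.center SL(2, ℤ))) =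
    principalPSL n from rfl, h, zero_dvd_iff] at this
  exact Subgroup.FiniteIndex.index_ne_zero this

/-- Minimality holds because Γ(M) contains `T^M`: if the kernel contains Γ(M), the order of `f(T)`
is at most `M`. -/
theorem isCongruencePSL_ker_and_level {G : Type*} [Group G] (f : PSL(2, ℤ) →* G)
    (h1 : 1 < orderOf (f modT)) (h : principalPSL (orderOf (f modT)) ≤ f.ker) :
    IsCongruencePSL f.ker ∧ levelPSL f.ker = orderOf (f modT) := by
  have := finiteIndex_principalPSL (zero_lt_one.trans h1)
  refine ⟨⟨Subgroup.finiteIndex_of_le h, _, h1, h⟩, le_antisymm (Nat.sInf_le ⟨h1.le, h⟩) ?_⟩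
  refine le_csInf ⟨_, h1.le, h⟩ ?_
  rintro M ⟨hM, hle⟩
  refine orderOf_le_of_pow_eq_one hM ?_
  rw [← map_pow]
  exact hle (modT_pow_mem_principalPSL M)

theorem commute_of_coe_eq_smul_one {d : ℕ} {g h : GL (Fin d) ℂ} {c : ℂ}
    (hg : (g : Matrix (Fin d) (Fin d) ℂ) = c • (1 : Matrix (Fin d) (Fin d) ℂ)) :
    Commute g h := by
  refine Units.ext ?_
  simp [hg]

/-- A representation of the modular group in which `T` is not scalar, of finite order, and of
projective order at most five has a congruence kernel of level the order of the image of `T`. -/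
theorem isCongruencePSL_ker_of_projOrder_le {d : ℕ} (ρ : PSL(2, ℤ) →* GL (Fin d) ℂ)
    (hfin : IsOfFinOrder (ρ modT))
    (hns : ¬ ∃ c : ℂ, (ρ modT : Matrix (Fin d) (Fin d) ℂ) = c • (1 : Matrix (Fin d) (Fin d) ℂ))
    (hpo : projOrder (ρ modT : Matrix (Fin d) (Fin d) ℂ) ≤ 5) :
    IsCongruencePSL ρ.ker ∧ levelPSL ρ.ker = orderOf (ρ modT) := by
  have hd : 0 < d := by
    rcases Nat.eq_zero_or_pos d with rfl | h
    · exact (hns ⟨0, Subsingleton.elim _ _⟩).elim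
    · exact h
  obtain ⟨t, h2, h5, ht, hmin⟩ := exists_projOrder_eq hpo
  have hN := hfin.orderOf_pos
  have hpow : (ρ modT : Matrix (Fin d) (Fin d) ℂ) ^ orderOf (ρ modT) = 1 := by
    rw [← Units.val_pow_eq_pow_val, pow_orderOf_eq_one, Units.val_one]
  obtain ⟨a₀, ha₀⟩ := exists_hasEigenvalue hd (ρ modT : Matrix (Fin d) (Fin d) ℂ)
  -- Ratios of eigenvalues are killed by both `t` and `N`, hence by their gcd. If the gcd exceeds 1,
  -- minimality of `t` makes it equal to `t`; if it is 1, all eigenvalues coincide and `ρ(T)` would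
  -- be scalar.
  have hdvd : t ∣ orderOf (ρ modT) := by
    set N := orderOf (ρ modT)
    have hgcd : ∀ a b : ℂ,
        Module.End.HasEigenvalue (Matrix.toLin' (ρ modT : Matrix (Fin d) (Fin d) ℂ)) a →
        Module.End.HasEigenvalue (Matrix.toLin' (ρ modT : Matrix (Fin d) (Fin d) ℂ)) b →
        a ^ t.gcd N = b ^ t.gcd N := by
      intro a b ha hb
      have hb1 := eigenvalue_pow_eq_one hpow hb
      have hb0 : b ≠ 0 := by
        rintro rfl
        rw [zero_pow hN.ne'] at hb1
        exact zero_ne_one hb1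
      rw [← div_eq_one_iff_eq (pow_ne_zero _ hb0), ← div_pow]
      refine pow_gcd_eq_one.mpr ⟨?_, ?_⟩
      · rw [div_pow, ht a b ha hb, div_self (pow_ne_zero _ hb0)]
      · rw [div_pow, eigenvalue_pow_eq_one hpow ha, hb1, div_one]
    have hpos : 0 < t.gcd N := Nat.gcd_pos_of_pos_right _ hN
    rcases Nat.lt_or_ge 1 (t.gcd N) with h | h
    · have := hmin _ h hgcd
      exact Nat.gcd_eq_left_iff_dvd.mp
        (le_antisymm (Nat.le_of_dvd (by omega) (Nat.gcd_dvd_left t N)) this)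
    · refine (hns ⟨a₀, ?_⟩).elim
      rw [show t.gcd N = 1 by omega] at hgcd
      have := pow_eq_smul_one_of_eigenvalues hN hpow (t := 1) (c := a₀)
        fun a ha ↦ by simpa using hgcd a a₀ ha ha₀
      rwa [pow_one] at this
  have hscalar := pow_eq_smul_one_of_eigenvalues hN hpow (t := t) (c := a₀ ^ t)
    fun a ha ↦ ht a a₀ ha ha₀
  rw [← Units.val_pow_eq_pow_val] at hscalar
  exact isCongruencePSL_ker_and_level ρ (h2.trans (Nat.le_of_dvd hN hdvd))
    (principalPSL_orderOf_le_ker ρ h2 h5 (fun g ↦ commute_of_coe_eq_smul_one hscalar) hdvd)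

/-! ### Irreducible representations -/

theorem not_common_eigenvector {G : Type*} [Group G] {d : ℕ} (hd : 2 ≤ d) {ρ : G →* GL (Fin d) ℂ}
    (hρ : IsIrreducibleRep ρ) {X : Set G} (hX : Subgroup.closure X = ⊤) {v : Fin d → ℂ}
    (hv : v ≠ 0)
    (h : ∀ x ∈ X, ∃ c : ℂ, (ρ x : Matrix (Fin d) (Fin d) ℂ).mulVec v = c • v) : False := by
  have hall : ∀ g : G, ∃ c : ℂ, (ρ g : Matrix (Fin d) (Fin d) ℂ).mulVec v = c • v := by
    intro g
    have hg : g ∈ Subgroup.closure X := hX ▸ Subgroup.mem_top g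
    induction hg using Subgroup.closure_induction with
    | mem x hx => exact h x hx
    | one => exact ⟨1, by simp⟩
    | mul x y _ _ hx hy =>
      obtain ⟨a, ha⟩ := hx
      obtain ⟨b, hb⟩ := hy
      refine ⟨b * a, ?_⟩
      rw [map_mul, Units.val_mul, ← Matrix.mulVec_mulVec, hb, Matrix.mulVec_smul, ha, smul_smul]
    | inv x _ hx =>
      obtain ⟨a, ha⟩ := hx
      have hinv : (ρ x⁻¹ : Matrix (Fin d) (Fin d) ℂ).mulVec
          ((ρ x : Matrix (Fin d) (Fin d) ℂ).mulVec v) = v := by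
        rw [Matrix.mulVec_mulVec, ← Units.val_mul, ← map_mul, inv_mul_cancel, map_one]
        simp
      rw [ha, Matrix.mulVec_smul] at hinv
      have ha0 : a ≠ 0 := by
        rintro rfl
        rw [zero_smul] at hinv
        exact hv hinv.symm
      refine ⟨a⁻¹, ?_⟩
      nth_rewrite 2 [← hinv]
      rw [smul_smul, inv_mul_cancel₀ ha0, one_smul]
  have hirr : (matRep ρ).IsIrreducible := hρ
  let L : Subrepresentation (matRep ρ) :=
    { toSubmodule := Submodule.span ℂ {v}
      apply_mem_toSubmodule := by
        intro g w hw
        obtain ⟨a, rfl⟩ := Submodule.mem_span_singleton.mp hw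
        obtain ⟨c, hc⟩ := hall g
        rw [map_smul]
        refine Submodule.smul_mem _ _ ?_
        change Matrix.toLin' (ρ g : Matrix (Fin d) (Fin d) ℂ) v ∈ _
        rw [Matrix.toLin'_apply, hc]
        exact Submodule.smul_mem _ _ (Submodule.mem_span_singleton_self v) }
  rcases eq_bot_or_eq_top L with hL | hL
  · have hmem : v ∈ L := Submodule.mem_span_singleton_self v
    rw [hL] at hmem
    exact hv hmem
  · have htop : Submodule.span ℂ {v} = ⊤ := congrArg Subrepresentation.toSubmodule hL
    have h1 := finrank_span_singleton (K := ℂ) hv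
    rw [htop, finrank_top, Module.finrank_fin_fun] at h1
    omega

/-- Schur's lemma: central elements act by scalars. -/
theorem exists_smul_one_of_central {G : Type*} [Group G] {d : ℕ} (hd : 0 < d)
    {ρ : G →* GL (Fin d) ℂ} (hρ : IsIrreducibleRep ρ) {z : G} (hz : ∀ g, Commute z g) :
    ∃ c : ℂ, (ρ z : Matrix (Fin d) (Fin d) ℂ) = c • (1 : Matrix (Fin d) (Fin d) ℂ) := by
  obtain ⟨c, hc⟩ := exists_hasEigenvalue hd (ρ z : Matrix (Fin d) (Fin d) ℂ)
  have hirr : (matRep ρ).IsIrreducible := hρ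
  let L : Subrepresentation (matRep ρ) :=
    { toSubmodule := Module.End.eigenspace (matRep ρ z) c
      apply_mem_toSubmodule := by
        intro g w hw
        rw [Module.End.mem_eigenspace_iff] at hw ⊢
        rw [← Module.End.mul_apply, ← map_mul, (hz g).eq, map_mul, Module.End.mul_apply, hw,
          map_smul] }
  refine ⟨c, ?_⟩
  rcases eq_bot_or_eq_top L with hL | hL
  · exact absurd (congrArg Subrepresentation.toSubmodule hL) hc
  · have htop : Module.End.eigenspace (matRep ρ z) c = ⊤ := congrArg Subrepresentation.toSubmodule hL
    apply Matrix.toLin'.injective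
    refine LinearMap.ext fun v ↦ ?_
    have : v ∈ Module.End.eigenspace (matRep ρ z) c := htop ▸ Submodule.mem_top
    have := Module.End.mem_eigenspace_iff.mp this
    simpa [matRep, Matrix.smul_mulVec] using this

/-! ### A bound on the order of a root of unity -/

/-- Galois conjugation: the relation is an integer polynomial in a primitive `M`-th root of unity
`ζ`, so it is divisible by the minimal polynomial of `ζ`, which also has the root `ζ^k`. -/
theorem conj_pow_relation {M : ℕ} (hM : 0 < M) {r ν : ℂ} (hr : r ^ M = 1) (hν : ν ^ M = 1)
    (h : r + r⁻¹ + 1 = ν + ν⁻¹) {k : ℕ} (hk : k.Coprime M) :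
    r ^ k + (r ^ k)⁻¹ + 1 = ν ^ k + (ν ^ k)⁻¹ := by
  have : NeZero M := ⟨hM.ne'⟩
  have hζ := Complex.isPrimitiveRoot_exp M hM.ne'
  set ζ := Complex.exp (2 * Real.pi * Complex.I / M)
  obtain ⟨a, -, rfl⟩ := hζ.eq_pow_of_pow_eq_one hr
  obtain ⟨b, -, rfl⟩ := hζ.eq_pow_of_pow_eq_one hν
  have hinv : ∀ x : ℂ, x ^ M = 1 → x⁻¹ = x ^ (M - 1) := by
    intro x hx
    rw [inv_eq_iff_eq_inv, eq_comm, inv_eq_of_mul_eq_one_left]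
    rw [← pow_succ', Nat.sub_add_cancel hM, hx]
  set P : Polynomial ℤ := Polynomial.X ^ a + (Polynomial.X ^ a) ^ (M - 1) + 1 -
    (Polynomial.X ^ b + (Polynomial.X ^ b) ^ (M - 1)) with hP
  have hP0 : Polynomial.aeval ζ P = 0 := by
    simp only [hP, map_sub, map_add, map_pow, Polynomial.aeval_X, map_one]
    rw [← hinv _ hr, ← hinv _ hν, h, sub_self]
  have hdvd : minpoly ℤ ζ ∣ P := minpoly.isIntegrallyClosed_dvd (hζ.isIntegral hM) hP0
  have hk0 : Polynomial.aeval (ζ ^ k) P = 0 := by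
    rw [hζ.minpoly_eq_pow_coprime hk] at hdvd
    exact Polynomial.aeval_eq_zero_of_dvd_aeval_eq_zero hdvd (minpoly.aeval ℤ _)
  simp only [hP, map_sub, map_add, map_pow, Polynomial.aeval_X, map_one] at hk0
  have hpow : ∀ c : ℕ, (ζ ^ c) ^ k = (ζ ^ k) ^ c := fun c ↦ by
    rw [← pow_mul, ← pow_mul, mul_comm]
  have hone : ∀ c : ℕ, ((ζ ^ k) ^ c) ^ M = 1 := fun c ↦ by
    rw [← pow_mul, ← pow_mul, show k * (c * M) = M * (k * c) by ring, pow_mul, hζ.pow_eq_one,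
      one_pow]
  rw [hpow, hpow, hinv _ (hone a), hinv _ (hone b)]
  exact sub_eq_zero.mp hk0

/-- The units of ℤ/M surject onto the units of ℤ/ord(r), so the conjugation taking `r` to the root
of unity with smallest positive argument is induced by an exponent coprime to `M`. -/
theorem exists_coprime_pow_eq_exp {M : ℕ} (hM : 0 < M) {r : ℂ} (hr : r ^ M = 1) :
    ∃ k : ℕ, k.Coprime M ∧ r ^ k = Complex.exp (2 * Real.pi * Complex.I / orderOf r) := by
  have : NeZero M := ⟨hM.ne'⟩
  have hdvd : orderOf r ∣ M := orderOf_dvd_of_pow_eq_one hr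
  have hn : 0 < orderOf r := Nat.pos_of_dvd_of_pos hdvd hM
  have : NeZero (orderOf r) := ⟨hn.ne'⟩
  obtain ⟨j, -, hj, hjr⟩ := ((IsPrimitiveRoot.orderOf r).isPrimitiveRoot_iff).mp
    (Complex.isPrimitiveRoot_exp (orderOf r) hn.ne')
  obtain ⟨u, hu⟩ := ZMod.unitsMap_surjective hdvd (ZMod.unitOfCoprime j hj)
  refine ⟨(u : ZMod M).val, ZMod.val_coe_unit_coprime u, ?_⟩
  have hmod : (u : ZMod M).val ≡ j [MOD orderOf r] := by
    have := congrArg Units.val hu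
    rw [ZMod.unitsMap_val, ZMod.coe_unitOfCoprime] at this
    rw [← ZMod.natCast_eq_natCast_iff, ← this, ZMod.natCast_val]
  rw [← hjr, ← pow_mod_orderOf, hmod, pow_mod_orderOf]

theorem re_inv_of_norm_eq_one {x : ℂ} (hx : ‖x‖ = 1) : (x⁻¹).re = x.re := by
  rw [Complex.inv_re, Complex.normSq_eq_norm_sq, hx]
  simp

/-- After conjugation the left side is `2 cos(2π/ord r) + 1` and the right side is at most 2, so the
cosine is at most 1/2. -/
theorem orderOf_le_six {M : ℕ} (hM : 0 < M) {r ν : ℂ} (hr : r ^ M = 1) (hν : ν ^ M = 1)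
    (h : r + r⁻¹ + 1 = ν + ν⁻¹) : orderOf r ≤ 6 := by
  obtain ⟨k, hk, hrk⟩ := exists_coprime_pow_eq_exp hM hr
  have hrel := conj_pow_relation hM hr hν h hk
  have hnorm : ∀ x : ℂ, x ^ M = 1 → ‖x ^ k‖ = 1 := fun x hx ↦ by
    rw [norm_pow, Complex.norm_eq_one_of_pow_eq_one hx hM.ne', one_pow]
  have hre := congrArg Complex.re hrel
  rw [Complex.add_re, Complex.add_re, Complex.add_re, re_inv_of_norm_eq_one (hnorm r hr),
    re_inv_of_norm_eq_one (hnorm ν hν), Complex.one_re] at hre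
  have hν1 : (ν ^ k).re ≤ 1 := (Complex.re_le_norm _).trans (hnorm ν hν).le
  by_contra! hlt
  have hn : (0 : ℝ) < orderOf r := by exact_mod_cast (by omega : 0 < orderOf r)
  have hn7 : (6 : ℝ) < orderOf r := by exact_mod_cast hlt
  have hcos : (r ^ k).re = Real.cos (2 * Real.pi / orderOf r) := by
    rw [hrk, show (2 * Real.pi * Complex.I / orderOf r : ℂ) =
      ((2 * Real.pi / orderOf r : ℝ) : ℂ) * Complex.I by push_cast; ring, Complex.exp_ofReal_mul_I_re]
  have hgt : Real.cos (Real.pi / 3) < Real.cos (2 * Real.pi / orderOf r) := by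
    have hpi := Real.pi_pos
    refine Real.cos_lt_cos_of_nonneg_of_le_pi (by positivity) (by linarith) ?_
    rw [div_lt_div_iff₀ hn (by norm_num)]
    nlinarith
  rw [Real.cos_pi_div_three] at hgt
  linarith

/-! ### Two-dimensional representations -/

theorem mul_self_fin_two {R : Type*} [CommRing R] (A : Matrix (Fin 2) (Fin 2) R) :
    A * A = A.trace • A - A.det • (1 : Matrix (Fin 2) (Fin 2) R) := by
  ext i j
  fin_cases i <;> fin_cases j <;>
    simp [Matrix.mul_apply, Fin.sum_univ_two, Matrix.trace_fin_two, Matrix.det_fin_two] <;> ring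

theorem eigenvalue_fin_two {A : Matrix (Fin 2) (Fin 2) ℂ} {a : ℂ}
    (h : Module.End.HasEigenvalue (Matrix.toLin' A) a) :
    a ^ 2 - A.trace * a + A.det = 0 := by
  obtain ⟨v, hv, hva⟩ := exists_mulVec_eq_of_hasEigenvalue h
  have h1 := congrArg (Matrix.mulVec · v) (mul_self_fin_two A)
  simp only [← Matrix.mulVec_mulVec, Matrix.sub_mulVec, Matrix.smul_mulVec, hva,
    Matrix.mulVec_smul, Matrix.one_mulVec, smul_smul] at h1
  rw [← sub_smul] at h1
  have := smul_left_injective ℂ hv h1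
  linear_combination this

theorem eq_smul_one_of_smul_eq {A : Matrix (Fin 2) (Fin 2) ℂ} {x y : ℂ} (hx : x ≠ 0)
    (h : x • A = y • (1 : Matrix (Fin 2) (Fin 2) ℂ)) :
    A = (x⁻¹ * y) • (1 : Matrix (Fin 2) (Fin 2) ℂ) := by
  rw [mul_smul, ← h, smul_smul, inv_mul_cancel₀ hx, one_smul]

theorem trace_det_of_sq_eq_one {A : Matrix (Fin 2) (Fin 2) ℂ} (h : A * A = 1)
    (hns : ¬ ∃ c : ℂ, A = c • (1 : Matrix (Fin 2) (Fin 2) ℂ)) : A.det = -1 := by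
  have hA := mul_self_fin_two A
  rw [h, eq_sub_iff_add_eq] at hA
  have h1 : A.trace • A = (1 + A.det) • (1 : Matrix (Fin 2) (Fin 2) ℂ) := by
    rw [← hA, add_smul, one_smul]
  have h0 : A.trace = 0 := by
    by_contra h0
    exact hns ⟨_, eq_smul_one_of_smul_eq h0 h1⟩
  rw [h0, zero_smul] at h1
  have := congrFun (congrFun h1 0) 0
  simp at this
  linear_combination -this

/-- By Cayley–Hamilton `A³` is a linear combination of `A` and 1; if `A` is not scalar, the
coefficients must match those of 1. -/
theorem trace_of_cube_eq_one {A : Matrix (Fin 2) (Fin 2) ℂ} (h : A * A * A = 1)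
    (hns : ¬ ∃ c : ℂ, A = c • (1 : Matrix (Fin 2) (Fin 2) ℂ)) :
    A.trace ^ 2 = A.det ∧ A.trace * A.det = -1 := by
  have hA := mul_self_fin_two A
  have h1 : (A.trace ^ 2 - A.det) • A =
      (1 + A.trace * A.det) • (1 : Matrix (Fin 2) (Fin 2) ℂ) := by
    rw [add_smul, one_smul]
    have h2 := h
    rw [hA, sub_mul, smul_mul_assoc, hA, smul_mul_assoc, one_mul] at h2
    refine sub_eq_iff_eq_add.mp (Eq.trans ?_ h2)
    module
  have h0 : A.trace ^ 2 - A.det = 0 := by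
    by_contra h0
    exact hns ⟨_, eq_smul_one_of_smul_eq h0 h1⟩
  rw [h0, zero_smul] at h1
  have := congrFun (congrFun h1 0) 0
  simp at this
  exact ⟨sub_eq_zero.mp h0, by linear_combination -this⟩

/-- Two invertible `2 × 2` matrices of finite order satisfying the braid relation, with trivial
full twist and no common eigenvector, have projective order at most five. -/
theorem projOrder_le_five_of_braid {A B : GL (Fin 2) ℂ} (hbraid : A * B * A = B * A * B)
    (htwist : (A * B) ^ 3 = 1) {N : ℕ} (hN : 0 < N) (hA : A ^ N = 1) (hE : (A * B⁻¹) ^ N = 1)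
    (hcommon : ∀ v : Fin 2 → ℂ, v ≠ 0 →
      ∀ a : ℂ, (A : Matrix (Fin 2) (Fin 2) ℂ).mulVec v = a • v →
      ¬ ∃ c : ℂ, ((A * B * A : GL (Fin 2) ℂ) : Matrix (Fin 2) (Fin 2) ℂ).mulVec v = c • v) :
    projOrder (A : Matrix (Fin 2) (Fin 2) ℂ) ≤ 5 := by
  obtain ⟨a₀, ha₀⟩ := exists_hasEigenvalue two_pos (A : Matrix (Fin 2) (Fin 2) ℂ)
  obtain ⟨v₀, hv₀, hva₀⟩ := exists_mulVec_eq_of_hasEigenvalue ha₀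
  have hM := (halfTwist_sq hbraid).trans htwist
  -- none of the relevant elements is scalar
  have hAns : ¬ ∃ c : ℂ, (A : Matrix (Fin 2) (Fin 2) ℂ) = c • 1 := by
    rintro ⟨c, hc⟩
    obtain ⟨b, hb⟩ := exists_hasEigenvalue two_pos
      ((A * B * A : GL (Fin 2) ℂ) : Matrix (Fin 2) (Fin 2) ℂ)
    obtain ⟨v, hv, hvb⟩ := exists_mulVec_eq_of_hasEigenvalue hb
    exact hcommon v hv c (by rw [hc, Matrix.smul_mulVec, Matrix.one_mulVec]) ⟨b, hvb⟩
  have hMns : ¬ ∃ c : ℂ, ((A * B * A : GL (Fin 2) ℂ) : Matrix (Fin 2) (Fin 2) ℂ) = c • 1 := by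
    rintro ⟨c, hc⟩
    exact hcommon v₀ hv₀ a₀ hva₀ ⟨c, by rw [hc, Matrix.smul_mulVec, Matrix.one_mulVec]⟩
  have hCns : ¬ ∃ c : ℂ, ((A * B : GL (Fin 2) ℂ) : Matrix (Fin 2) (Fin 2) ℂ) = c • 1 := by
    rintro ⟨c, hc⟩
    exact hcommon v₀ hv₀ a₀ hva₀ ⟨c * a₀, by
      rw [Units.val_mul, hc, Matrix.smul_mul, one_mul, Matrix.smul_mulVec, hva₀, smul_smul]⟩
  have hEns : ¬ ∃ c : ℂ, ((A * B⁻¹ : GL (Fin 2) ℂ) : Matrix (Fin 2) (Fin 2) ℂ) = c • 1 := by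
    rintro ⟨c, hc⟩
    have hcB : (A : Matrix (Fin 2) (Fin 2) ℂ) = c • (B : Matrix (Fin 2) (Fin 2) ℂ) := by
      rw [show A = A * B⁻¹ * B by group, Units.val_mul, hc, Matrix.smul_mul, one_mul]
    have hc0 : c ≠ 0 := by
      rintro rfl
      rw [zero_smul] at hcB
      exact A.ne_zero hcB
    refine hcommon v₀ hv₀ a₀ hva₀ ⟨a₀ * (c⁻¹ * a₀ * a₀), ?_⟩
    have hB : (B : Matrix (Fin 2) (Fin 2) ℂ).mulVec v₀ = (c⁻¹ * a₀) • v₀ := by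
      rw [mul_smul, ← hva₀, hcB, Matrix.smul_mulVec, smul_smul, inv_mul_cancel₀ hc0, one_smul]
    rw [Units.val_mul, Units.val_mul, ← Matrix.mulVec_mulVec, ← Matrix.mulVec_mulVec, hva₀,
      Matrix.mulVec_smul, hB, Matrix.mulVec_smul, Matrix.mulVec_smul, hva₀, smul_smul, smul_smul]
    congr 1; ring
  -- traces and determinants
  have hconj : B = (A * B) * A * (A * B)⁻¹ := by
    rw [eq_mul_inv_iff_mul_eq, ← mul_assoc, ← hbraid]
  set D := (A : Matrix (Fin 2) (Fin 2) ℂ).det with hD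
  set τ := (A : Matrix (Fin 2) (Fin 2) ℂ).trace with hτ
  have hD0 : D ≠ 0 := by
    have := (Matrix.isUnit_iff_isUnit_det _).mp A.isUnit
    exact this.ne_zero
  have hBdet : (B : Matrix (Fin 2) (Fin 2) ℂ).det = D := by
    rw [hconj, Units.val_mul, Units.val_mul, Matrix.coe_units_inv, Matrix.det_conj]
    exact (A * B).isUnit
  have hBtr : (B : Matrix (Fin 2) (Fin 2) ℂ).trace = τ := by
    rw [hconj, Units.val_mul _ (A * B)⁻¹, Units.val_mul, Matrix.trace_mul_comm, ← mul_assoc,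
      Units.inv_mul, one_mul]
  have hD3 : D ^ 3 = -1 := by
    have := trace_det_of_sq_eq_one (by rw [← Units.val_mul, hM, Units.val_one]) hMns
    rw [Units.val_mul, Units.val_mul, Matrix.det_mul, Matrix.det_mul, hBdet, ← hD] at this
    linear_combination this
  have hC : ((A * B : GL (Fin 2) ℂ) : Matrix (Fin 2) (Fin 2) ℂ).trace = D := by
    obtain ⟨-, h2⟩ := trace_of_cube_eq_one (by
      rw [← Units.val_mul, ← Units.val_mul, ← pow_two, ← pow_succ, htwist, Units.val_one]) hCns
    rw [Units.val_mul, Matrix.det_mul, hBdet, ← hD, ← Units.val_mul] at h2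
    have : D ^ 2 ≠ 0 := pow_ne_zero 2 hD0
    refine mul_right_cancel₀ this ?_
    linear_combination h2 - hD3
  set E := ((A * B⁻¹ : GL (Fin 2) ℂ) : Matrix (Fin 2) (Fin 2) ℂ) with hEdef
  have hEdet : E.det = 1 := by
    rw [hEdef, Units.val_mul, Matrix.det_mul, Matrix.coe_units_inv, Matrix.det_nonsing_inv, hBdet,
      ← hD, Ring.inverse_eq_inv', mul_inv_cancel₀ hD0]
  have hEB : E * (B : Matrix (Fin 2) (Fin 2) ℂ) = A := by
    rw [hEdef, ← Units.val_mul, inv_mul_cancel_right]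
  -- Cayley–Hamilton for `B` gives `AB = E B² = τA - D E`; the trace of `AB` is `D`. Dividing by `D
  -- = a₀a₁` turns the result into `r + r⁻¹ + 1 = tr E`.
  have hEtr : τ ^ 2 - D * E.trace = D := by
    have h1 : (A : Matrix (Fin 2) (Fin 2) ℂ) * B = τ • (A : Matrix (Fin 2) (Fin 2) ℂ) - D • E := by
      nth_rewrite 1 [← hEB]
      rw [mul_assoc, mul_self_fin_two (B : Matrix (Fin 2) (Fin 2) ℂ), hBdet, hBtr, mul_sub,
        Matrix.mul_smul, Matrix.mul_smul, hEB, mul_one]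
    have h2 := congrArg Matrix.trace h1
    rw [← Units.val_mul, hC, Matrix.trace_sub, Matrix.trace_smul, Matrix.trace_smul, ← hτ,
      smul_eq_mul, smul_eq_mul] at h2
    linear_combination -h2
  -- eigenvalues
  have hApow : (A : Matrix (Fin 2) (Fin 2) ℂ) ^ N = 1 := by
    rw [← Units.val_pow_eq_pow_val, hA, Units.val_one]
  have hEpow : E ^ N = 1 := by
    rw [hEdef, ← Units.val_pow_eq_pow_val, hE, Units.val_one]
  obtain ⟨a₁, ha₁, hne⟩ : ∃ a, Module.End.HasEigenvalue
      (Matrix.toLin' (A : Matrix (Fin 2) (Fin 2) ℂ)) a ∧ a ≠ a₀ := by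
    by_contra! hall
    have := pow_eq_smul_one_of_eigenvalues hN hApow (t := 1) (c := a₀)
      fun a ha ↦ by rw [pow_one, hall a ha]
    exact hAns ⟨a₀, by rwa [pow_one] at this⟩
  have e0 := eigenvalue_fin_two ha₀
  have e1 := eigenvalue_fin_two ha₁
  rw [← hτ, ← hD] at e0 e1
  have hsum : τ = a₀ + a₁ := by
    refine mul_left_cancel₀ (sub_ne_zero.mpr hne) ?_
    linear_combination e0 - e1
  have hprod : D = a₀ * a₁ := by
    rw [hsum] at e0
    linear_combination e0
  have ha₀0 : a₀ ≠ 0 := by rintro rfl; simp [hD0] at hprod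
  have ha₁0 : a₁ ≠ 0 := by rintro rfl; simp [hD0] at hprod
  obtain ⟨ν, hν⟩ := exists_hasEigenvalue two_pos E
  have eν := eigenvalue_fin_two hν
  rw [hEdet] at eν
  have hν0 : ν ≠ 0 := by rintro rfl; simp at eν
  set r := a₀ / a₁ with hr
  have hrN : r ^ N = 1 := by
    rw [hr, div_pow, eigenvalue_pow_eq_one hApow ha₀, eigenvalue_pow_eq_one hApow ha₁, div_one]
  have hrtr : r + r⁻¹ + 1 = E.trace := by
    rw [hsum, hprod] at hEtr
    rw [hr]
    field_simp
    linear_combination hEtr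
  have hνtr : ν + ν⁻¹ = E.trace := by
    field_simp
    linear_combination eν
  have hle := orderOf_le_six hN hrN (eigenvalue_pow_eq_one hEpow hν) (hrtr.trans hνtr.symm)
  have hr1 : orderOf r ≠ 1 := by
    rw [Ne, orderOf_eq_one_iff, hr, div_eq_one_iff_eq ha₁0]
    exact hne.symm
  have hrpos : 0 < orderOf r := orderOf_pos_iff.mpr (isOfFinOrder_iff_pow_eq_one.mpr ⟨N, hN, hrN⟩)
  -- Order 6 means `r + r⁻¹ = 1`, so `E` has trace 2 and determinant 1. Its only eigenvalue is 1 and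
  -- its order is finite, so `E = 1`, which is excluded.
  have hr6 : orderOf r ≠ 6 := by
    intro h6
    have hr0 : r ≠ 0 := div_ne_zero ha₀0 ha₁0
    have hprim : IsPrimitiveRoot r 6 := h6 ▸ IsPrimitiveRoot.orderOf r
    have h3 : r ^ 3 ≠ 1 := hprim.pow_ne_one_of_pos_of_lt (by norm_num) (by norm_num)
    have h2 : r ^ 2 ≠ 1 := hprim.pow_ne_one_of_pos_of_lt (by norm_num) (by norm_num)
    have h6' := hprim.pow_eq_one
    have hcyc : r ^ 2 - r + 1 = 0 := by
      have hf : (r ^ 3 - 1) * ((r + 1) * (r ^ 2 - r + 1)) = 0 := by linear_combination h6'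
      rcases mul_eq_zero.mp hf with hf | hf
      · exact absurd (sub_eq_zero.mp hf) h3
      · rcases mul_eq_zero.mp hf with hf | hf
        · exact absurd (by linear_combination (r - 1) * hf) h2
        · exact hf
    have htr2 : E.trace = 2 := by
      rw [← hrtr]
      field_simp
      linear_combination hcyc
    have := pow_eq_smul_one_of_eigenvalues hN hEpow (t := 1) (c := 1) fun a ha ↦ by
      have := eigenvalue_fin_two ha
      rw [htr2, hEdet] at this
      have : (a - 1) ^ 2 = 0 := by linear_combination this
      rw [pow_one]
      exact sub_eq_zero.mp (pow_eq_zero_iff two_ne_zero |>.mp this)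
    exact hEns ⟨1, by rwa [pow_one] at this⟩
  have h01 : a₀ ^ orderOf r = a₁ ^ orderOf r := by
    have := pow_orderOf_eq_one r
    rwa [← div_eq_one_iff_eq (pow_ne_zero _ ha₁0), ← div_pow]
  have hroot : ∀ a, Module.End.HasEigenvalue (Matrix.toLin' (A : Matrix (Fin 2) (Fin 2) ℂ)) a →
      a ^ orderOf r = a₀ ^ orderOf r := by
    intro a ha
    have ea := eigenvalue_fin_two ha
    rw [← hτ, ← hD, hsum, hprod] at ea
    have : (a - a₀) * (a - a₁) = 0 := by linear_combination ea
    rcases mul_eq_zero.mp this with h | h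
    · rw [sub_eq_zero.mp h]
    · rw [sub_eq_zero.mp h, h01]
  refine (projOrder_le (t := orderOf r) (by omega) fun a b ha hb ↦ by
    rw [hroot a ha, hroot b hb]).trans ?_
  exact_mod_cast (by omega : orderOf r ≤ 5)

/-! ### Finite image and scalings -/

theorem isOfFinOrder_of_hasFiniteImage {G : Type*} [Group G] {d : ℕ} {ρ : G →* GL (Fin d) ℂ}
    (h : HasFiniteImage ρ) (g : G) : IsOfFinOrder (ρ g) := by
  refine finite_powers.mp (h.subset ?_)
  rintro _ ⟨n, rfl⟩
  exact ⟨g ^ n, map_pow ρ g n⟩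

theorem modular_closure :
    Subgroup.closure {(QuotientGroup.mk ModularGroup.S : PSL(2, ℤ)), modT} = ⊤ := by
  rw [eq_top_iff]
  rintro ⟨A⟩ -
  exact mem_closure_S_T_image (QuotientGroup.mk' (Subgroup.center SL(2, ℤ))) A

theorem modT_not_smul_one {d : ℕ} (hd : 2 ≤ d) {ρ : PSL(2, ℤ) →* GL (Fin d) ℂ}
    (hρ : IsIrreducibleRep ρ) :
    ¬ ∃ c : ℂ, (ρ modT : Matrix (Fin d) (Fin d) ℂ) = c • (1 : Matrix (Fin d) (Fin d) ℂ) := by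
  rintro ⟨c, hc⟩
  obtain ⟨b, hb⟩ := exists_hasEigenvalue (zero_lt_two.trans_le hd)
    (ρ (QuotientGroup.mk ModularGroup.S) : Matrix (Fin d) (Fin d) ℂ)
  obtain ⟨v, hv, hvb⟩ := exists_mulVec_eq_of_hasEigenvalue hb
  refine not_common_eigenvector hd hρ modular_closure hv ?_
  rintro _ (rfl | rfl)
  · exact ⟨b, hvb⟩
  · exact ⟨c, by rw [hc, Matrix.smul_mulVec, Matrix.one_mulVec]⟩

theorem projOrder_modT_le_five {ρ : PSL(2, ℤ) →* GL (Fin 2) ℂ} (hρ : IsIrreducibleRep ρ)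
    (hfin : HasFiniteImage ρ) : projOrder (ρ modT : Matrix (Fin 2) (Fin 2) ℂ) ≤ 5 := by
  have hrel := congrArg (ρ.comp braidProj) braid_relation
  have hS : ρ modT * ρ modU⁻¹ * ρ modT = ρ (QuotientGroup.mk ModularGroup.S) := by
    simp only [← braidProj_halfTwist, map_mul, braidProj_σ₁, braidProj_σ₂]
  have hbraid : ρ modT * ρ modU⁻¹ * ρ modT = ρ modU⁻¹ * ρ modT * ρ modU⁻¹ := by
    simpa only [MonoidHom.comp_apply, map_mul, braidProj_σ₁, braidProj_σ₂] using hrel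
  have hSS : ρ (QuotientGroup.mk ModularGroup.S) * ρ (QuotientGroup.mk ModularGroup.S) = 1 := by
    rw [← map_mul, ← map_one ρ]
    refine congrArg ρ ((congrArg (QuotientGroup.mk' (Subgroup.center SL(2, ℤ)))
      modularS_mul_S).trans mk_modular_neg_one)
  have htwist : (ρ modT * ρ modU⁻¹) ^ 3 = 1 := by
    rw [← halfTwist_sq hbraid, hS, hSS]
  obtain ⟨N₁, hN₁, hA⟩ := (isOfFinOrder_of_hasFiniteImage hfin modT).exists_pow_eq_one
  obtain ⟨N₂, hN₂, hE⟩ := (isOfFinOrder_of_hasFiniteImage hfin (modT * (modU⁻¹)⁻¹)).exists_pow_eq_one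
  rw [map_mul, map_inv ρ modU⁻¹] at hE
  refine projOrder_le_five_of_braid hbraid htwist (Nat.mul_pos hN₁ hN₂)
    (by rw [pow_mul, hA, one_pow]) (by rw [mul_comm, pow_mul, hE, one_pow]) ?_
  rintro v hv a ha ⟨c, hc⟩
  rw [hS] at hc
  refine not_common_eigenvector le_rfl hρ modular_closure hv ?_
  rintro _ (rfl | rfl)
  exacts [⟨c, hc⟩, ⟨a, ha⟩]

/-- The twist of a matrix representation by a character. -/
noncomputable def twistRep {G : Type*} [Group G] {d : ℕ} (χ : G →* ℂˣ) (ρ : G →* GL (Fin d) ℂ) :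
    G →* GL (Fin d) ℂ where
  toFun g := Units.map (algebraMap ℂ (Matrix (Fin d) (Fin d) ℂ)).toMonoidHom (χ g) * ρ g
  map_one' := by simp
  map_mul' g h := by
    refine Units.ext ?_
    simp only [map_mul, Units.val_mul, Units.coe_map]
    have := Algebra.commutes (χ h : ℂ) (ρ g : Matrix (Fin d) (Fin d) ℂ)
    simp only [RingHom.toMonoidHom_eq_coe, MonoidHom.coe_coe, mul_assoc]
    rw [← mul_assoc _ (ρ g : Matrix (Fin d) (Fin d) ℂ), this]
    simp only [mul_assoc]

theorem twistRep_coe {G : Type*} [Group G] {d : ℕ} (χ : G →* ℂˣ) (ρ : G →* GL (Fin d) ℂ) (g : G) :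
    (twistRep χ ρ g : Matrix (Fin d) (Fin d) ℂ) =
      (χ g : ℂ) • (ρ g : Matrix (Fin d) (Fin d) ℂ) := by
  simp [twistRep, Algebra.smul_def]

theorem IsScaling.trans {G : Type*} [Group G] {d : ℕ} {ρ₁ ρ₂ ρ₃ : G →* GL (Fin d) ℂ}
    (h₁ : IsScaling ρ₁ ρ₂) (h₂ : IsScaling ρ₂ ρ₃) : IsScaling ρ₁ ρ₃ := by
  obtain ⟨χ, hχ⟩ := h₁
  obtain ⟨ψ, hψ⟩ := h₂
  exact ⟨χ * ψ, fun g ↦ by rw [hχ, hψ, smul_smul]; rfl⟩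

/-- The character of the braid group with value `θ` on both generators. -/
noncomputable def braidChar (θ : ℂˣ) : BraidGroup3 →* ℂˣ :=
  PresentedGroup.toGroup (f := fun _ ↦ θ) (by
    rintro _ rfl
    simp)

theorem braidChar_σ₁ (θ : ℂˣ) : braidChar θ braidσ₁ = θ := by simp [braidChar, braidσ₁]

theorem braidChar_σ₂ (θ : ℂˣ) : braidChar θ braidσ₂ = θ := by simp [braidChar, braidσ₂]

theorem commute_fullTwist (g : BraidGroup3) : Commute ((braidσ₁ * braidσ₂) ^ 3) g := by
  have hg : g ∈ Subgroup.closure {braidσ₁, braidσ₂} := braid_closure ▸ Subgroup.mem_top g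
  have h := braid_relation
  have h1 := mul_halfTwist h
  have h2 : braidσ₂ * (braidσ₁ * braidσ₂ * braidσ₁) =
      braidσ₁ * braidσ₂ * braidσ₁ * braidσ₁ := by
    rw [← mul_assoc, ← mul_assoc, ← h]
  have hc1 : Commute ((braidσ₁ * braidσ₂) ^ 3) braidσ₁ := by
    rw [← halfTwist_sq h]
    refine Commute.symm ?_
    rw [commute_iff_eq, ← mul_assoc braidσ₁, h1, mul_assoc _ braidσ₂, h2, ← mul_assoc]
  have hc2 : Commute ((braidσ₁ * braidσ₂) ^ 3) braidσ₂ := by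
    rw [← halfTwist_sq h]
    refine Commute.symm ?_
    rw [commute_iff_eq, ← mul_assoc braidσ₂, h2, mul_assoc _ braidσ₁, h1, ← mul_assoc]
  refine (Subgroup.closure_le (Subgroup.centralizer {(braidσ₁ * braidσ₂) ^ 3})).mpr ?_ hg
    _ rfl
  rintro _ (rfl | rfl) _ rfl
  exacts [hc1, hc2]

theorem braidσ₁_not_smul_one {d : ℕ} (hd : 2 ≤ d) {ρ : BraidGroup3 →* GL (Fin d) ℂ}
    (hρ : IsIrreducibleRep ρ) :
    ¬ ∃ c : ℂ, (ρ braidσ₁ : Matrix (Fin d) (Fin d) ℂ) = c • (1 : Matrix (Fin d) (Fin d) ℂ) := by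
  rintro ⟨c, hc⟩
  obtain ⟨b, hb⟩ := exists_hasEigenvalue (zero_lt_two.trans_le hd)
    (ρ braidσ₂ : Matrix (Fin d) (Fin d) ℂ)
  obtain ⟨v, hv, hvb⟩ := exists_mulVec_eq_of_hasEigenvalue hb
  refine not_common_eigenvector hd hρ braid_closure hv ?_
  rintro _ (rfl | rfl)
  · exact ⟨c, by rw [hc, Matrix.smul_mulVec, Matrix.one_mulVec]⟩
  · exact ⟨b, hvb⟩

/-- An essentially finite irreducible representation of the braid group has a scaling that kills
the full twist and sends the generators to elements of finite order. -/
theorem exists_scaling_fullTwist_eq_one {d : ℕ} (hd : 0 < d) {ρ : BraidGroup3 →* GL (Fin d) ℂ}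
    (hρ : IsIrreducibleRep ρ) (hfin : IsEssentiallyFinite ρ) :
    ∃ ρ' : BraidGroup3 →* GL (Fin d) ℂ, IsScaling ρ' ρ ∧ ρ' ((braidσ₁ * braidσ₂) ^ 3) = 1 ∧
      IsOfFinOrder (ρ' braidσ₁) := by
  have : Nonempty (Fin d) := ⟨⟨0, hd⟩⟩
  obtain ⟨ρ₁, hscal, hρ₁⟩ := hfin
  obtain ⟨c₀, hc₀⟩ := exists_smul_one_of_central hd hρ commute_fullTwist
  obtain ⟨c, hc⟩ : ∃ c : ℂ, (ρ₁ ((braidσ₁ * braidσ₂) ^ 3) : Matrix (Fin d) (Fin d) ℂ) = c • 1 := by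
    obtain ⟨χ, hχ⟩ := hscal
    exact ⟨_, by rw [hχ, hc₀, smul_smul]⟩
  obtain ⟨K, hK, hcK⟩ :=
    (isOfFinOrder_of_hasFiniteImage hρ₁ ((braidσ₁ * braidσ₂) ^ 3)).exists_pow_eq_one
  obtain ⟨L, hL, hσL⟩ := (isOfFinOrder_of_hasFiniteImage hρ₁ braidσ₁).exists_pow_eq_one
  have hcK1 : c ^ K = 1 := by
    have h := congrArg Units.val hcK
    rw [Units.val_pow_eq_pow_val, hc, smul_pow, one_pow, Units.val_one] at h
    simpa using congrFun (congrFun h ⟨0, hd⟩) ⟨0, hd⟩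
  have hc0 : c ≠ 0 := by
    rintro rfl
    rw [zero_pow hK.ne'] at hcK1
    exact zero_ne_one hcK1
  -- The full twist is a positive word of length 6, so twisting by `θ` multiplies its scalar `c` by
  -- `θ⁶ = c⁻¹`. As `c` is a root of unity, so is `θ`, and `σ₁` keeps finite order.
  obtain ⟨θ, hθ⟩ := IsAlgClosed.exists_pow_nat_eq c⁻¹ (n := 6) (by norm_num)
  have hθ0 : θ ≠ 0 := by
    rintro rfl
    rw [zero_pow (by norm_num)] at hθ
    exact inv_ne_zero hc0 hθ.symm
  set χ := braidChar (Units.mk0 θ hθ0)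
  refine ⟨twistRep χ ρ₁, IsScaling.trans ⟨χ, twistRep_coe χ ρ₁⟩ hscal, ?_, ?_⟩
  · refine Units.ext ?_
    rw [twistRep_coe, hc, smul_smul, map_pow, map_mul, braidChar_σ₁, braidChar_σ₂,
      Units.val_pow_eq_pow_val, Units.val_mul, Units.val_mk0, ← pow_two, ← pow_mul, hθ,
      inv_mul_cancel₀ hc0, one_smul, Units.val_one]
  · refine isOfFinOrder_iff_pow_eq_one.mpr ⟨6 * K * L, by positivity, Units.ext ?_⟩
    rw [Units.val_pow_eq_pow_val, twistRep_coe, braidChar_σ₁, Units.val_mk0, smul_pow, pow_mul,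
      pow_mul, hθ, inv_pow, hcK1, inv_one, one_pow, one_smul, mul_comm (6 * K), pow_mul,
      ← Units.val_pow_eq_pow_val, hσL, Units.val_one, one_pow]

/-! ### Assembly of the theorem -/

theorem map_braidProj_ker_comp {G : Type*} [Group G] (f : PSL(2, ℤ) →* G) :
    (f.comp braidProj).ker.map braidProj = f.ker := by
  rw [← MonoidHom.comap_ker, Subgroup.map_comap_eq_self_of_surjective braidProj_surjective]

theorem exists_congruence_scaling {d : ℕ} (hd : 2 ≤ d) {ρ : BraidGroup3 →* GL (Fin d) ℂ}
    (hρ : IsIrreducibleRep ρ) (hfin : IsEssentiallyFinite ρ)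
    (hpo : projOrder (ρ braidσ₁ : Matrix (Fin d) (Fin d) ℂ) ≤ 5) :
    ∃ ρ' : BraidGroup3 →* GL (Fin d) ℂ, IsScaling ρ' ρ ∧
      (∃ ρbar : PSL(2, ℤ) →* GL (Fin d) ℂ, ρ' = ρbar.comp braidProj) ∧
      IsCongruencePSL (ρ'.ker.map braidProj) ∧
      levelPSL (ρ'.ker.map braidProj) = orderOf (ρ' braidσ₁) := by
  obtain ⟨ρ', hscal, htwist, hord⟩ :=
    exists_scaling_fullTwist_eq_one (zero_lt_two.trans_le hd) hρ hfin
  obtain ⟨ρbar, rfl⟩ := exists_factor_braidProj ρ' htwist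
  refine ⟨_, hscal, ⟨ρbar, rfl⟩, ?_⟩
  rw [map_braidProj_ker_comp]
  have hT : (ρbar.comp braidProj) braidσ₁ = ρbar modT := congrArg ρbar braidProj_σ₁
  obtain ⟨χ, hχ⟩ := hscal
  have hσ := hχ braidσ₁
  rw [hT] at hord hσ ⊢
  refine isCongruencePSL_ker_of_projOrder_le ρbar hord ?_ ?_
  · rintro ⟨c, hc⟩
    refine braidσ₁_not_smul_one hd hρ ⟨((χ braidσ₁ : ℂ))⁻¹ * c, ?_⟩
    rw [mul_smul, ← hc, hσ, smul_smul, inv_mul_cancel₀ (Units.ne_zero _), one_smul]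
  · rw [hσ]
    exact (projOrder_smul_le _ (Units.ne_zero _)).trans hpo

theorem theoremA :
    -- representations of the braid group
    (∀ d : ℕ, d = 2 ∨ d = 3 → ∀ ρ : BraidGroup3 →* GL (Fin d) ℂ,
      IsIrreducibleRep ρ → IsEssentiallyFinite ρ →
      2 ≤ projOrder (ρ braidσ₁ : Matrix (Fin d) (Fin d) ℂ) →
      projOrder (ρ braidσ₁ : Matrix (Fin d) (Fin d) ℂ) ≤ 5 →
      ∃ ρ' : BraidGroup3 →* GL (Fin d) ℂ, IsScaling ρ' ρ ∧
        (∃ ρbar : PSL(2, ℤ) →* GL (Fin d) ℂ, ρ' = ρbar.comp braidProj) ∧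
        IsCongruencePSL (ρ'.ker.map braidProj) ∧
        levelPSL (ρ'.ker.map braidProj) = orderOf (ρ' braidσ₁)) ∧
    -- two-dimensional representations of the modular group
    (∀ ρ : PSL(2, ℤ) →* GL (Fin 2) ℂ, IsIrreducibleRep ρ → HasFiniteImage ρ →
      IsCongruencePSL ρ.ker ∧ levelPSL ρ.ker = orderOf (ρ modT)) ∧
    -- three-dimensional representations of the modular group
    (∀ ρ : PSL(2, ℤ) →* GL (Fin 3) ℂ, IsIrreducibleRep ρ → HasFiniteImage ρ →
      2 ≤ projOrder (ρ modT : Matrix (Fin 3) (Fin 3) ℂ) →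
      projOrder (ρ modT : Matrix (Fin 3) (Fin 3) ℂ) ≤ 5 →
      IsCongruencePSL ρ.ker ∧ levelPSL ρ.ker = orderOf (ρ modT)) := by
  refine ⟨?_, ?_, ?_⟩
  · rintro d hd ρ hρ hfin - hpo
    exact exists_congruence_scaling (by omega) hρ hfin hpo
  · intro ρ hρ hfin
    exact isCongruencePSL_ker_of_projOrder_le ρ (isOfFinOrder_of_hasFiniteImage hfin _)
      (modT_not_smul_one le_rfl hρ) (projOrder_modT_le_five hρ hfin)
  · rintro ρ hρ hfin - hpo
    exact isCongruencePSL_ker_of_projOrder_le ρ (isOfFinOrder_of_hasFiniteImage hfin _)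
      (modT_not_smul_one (by norm_num) hρ) hpo
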